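/- **Setting.** Let $(X_i,Y_i)_{i\ge1}$ be i.i.d. random vectors in $\mathbb R^2$ with continuous marginal distribution functions $F,G$ and copula $C$, i.e. $\mathbf P(X_1\le x,Y_1\le y)=C(F(x),G(y))$. For $n\ge1$ let $R_{X_i},R_{Y_i}$ be the ranks of $X_i,Y_i$ among $X_1,\dots,X_n$ and $Y_1,\dots,Y_n$, and let $$\hat C_n(u,v)=\frac1n\sum_{i=1}^n\mathbf 1\{R_{X_i}/n\le u,\ R_{Y_i}/n\le v\},\qquad (u,v)\in[0,1]^2,$$ be the empirical copula. For an integer $m\ge1$ let $\hat C_n^{(m)}$ be the empirical checkerboard copula, i.e. the function on $[0,1]^2$ that interpolates $\hat C_n$ bilinearly on every cell of the grid $\{0,\frac1m,\dots,1\}^2$. Let $\overline{\mathbb R}_+^2=[0,\infty]^2\setminus\{(\infty,\infty)\}$. For a function $D$ on $[0,1]^2$ and $t>0$ put $$D_{L,t}(x,y)=\frac{D(x_t,y_t)}{t},\qquad D_{U,t}(x,y)=\frac{x_t+y_t-1+D(1-x_t,1-y_t)}{t},\qquad x_t=\min(tx,1),\ y_t=\min(ty,1),$$ for $(x,y)\in\overline{\mathbb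 R}_+^2$ (so $x_t=1$ if $x=\infty$, and $x_t=tx$ if $x<\infty$ and $t$ is small). The lower and upper tail copulas of $C$ are $\Lambda_L=\lim_{t\downarrow0}C_{L,t}$ and $\Lambda_U=\lim_{t\downarrow0}C_{U,t}$ (pointwise limits), whenever they exist; thus $\Lambda(x,\infty)=x$ and $\Lambda(\infty,y)=y$ for both. Let $k_n>0$ be real numbers and $m=m_n\ge1$ integers. With $t_n=k_n/n$, the empirical tail copulas are $\hat\Lambda_{L,n}=(\hat C_n)_{L,t_n}$ and $\hat\Lambda_{U,n}=(\hat C_n)_{U,t_n}$, and the checkerboard tail copula estimators are $\hat\Lambda^{(m)}_{L,n}=(\hat C^{(m)}_n)_{L,t_n}$ and $\hat\Lambda^{(m)}_{U,n}=(\hat C^{(m)}_n)_{U,t_n}$. Let $T_0=\emptyset$ and, for $i\ge1$, $T_{3i-2}=T_{3i-3}\cup(\{\infty\}\times[0,i])$, $T_{3i-1}=T_{3i-2}\cup([0,i]\times\{\infty\})$, $T_{3i}=T_{3i-1}\cup[0,i]^2$. Let $B_\infty(\overline{\mathbb R}_+^2)$ be the space of functions $f:\overline{\mathbb R}_+^2\to\mathbb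 R$ that are bounded on every $T_i$, with the metric $d(f,g)=\sum_{i\ge1}2^{-i}\bigl(\sup_{T_i}|f-g|\wedge1\bigr)$. **Theorem.** Assume $k_n\to\infty$, $k_n/n\to0$, $n/\sqrt{k_n}=o(m_n)$ and $(\log n)^2=o(k_n)$. 1. If $\Lambda_L$ exists, then almost surely $\hat\Lambda^{(m)}_{L,n}\to\Lambda_L$ in $B_\infty(\overline{\mathbb R}_+^2)$ and uniformly on every $T_i$. 2. If $\Lambda_U$ exists, then almost surely $\hat\Lambda^{(m)}_{U,n}\to\Lambda_U$ in $B_\infty(\overline{\mathbb R}_+^2)$ and uniformly on every $T_i$. 3. Almost surely, for every $n\ge1$, $$\sup_{\overline{\mathbb R}_+^2}\bigl|\hat\Lambda^{(m)}_{L,n}-\hat\Lambda_{L,n}\bigr|\le\frac{2n}{k_nm_n}+\frac{2}{k_n},\qquad \sup_{\overline{\mathbb R}_+^2}\bigl|\hat\Lambda^{(m)}_{U,n}-\hat\Lambda_{U,n}\bigr|\le\frac{2n}{k_nm_n}+\frac{2}{k_n},$$ and both suprema are at most $\dfrac{4n}{k_nm_n}$ if $m_n\le n$. -/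

import Mathlib

open MeasureTheory ProbabilityTheory Filter Topology Asymptotics
open scoped ENNReal

noncomputable section

namespace CheckerboardTail

/-- A bivariate copula, seen as a function of two real variables of which only the values
on `[0,1]²` matter: grounded, with uniform margins, and 2-increasing. -/
structure IsCopula (C : ℝ → ℝ → ℝ) : Prop where
  zero_left : ∀ v ∈ Set.Icc (0 : ℝ) 1, C 0 v = 0
  zero_right : ∀ u ∈ Set.Icc (0 : ℝ) 1, C u 0 = 0
  one_left : ∀ v ∈ Set.Icc (0 : ℝ) 1, C 1 v = v
  one_right : ∀ u ∈ Set.Icc (0 : ℝ) 1, C u 1 = u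
  two_increasing : ∀ u₁ u₂ v₁ v₂ : ℝ, 0 ≤ u₁ → u₁ ≤ u₂ → u₂ ≤ 1 → 0 ≤ v₁ → v₁ ≤ v₂ → v₂ ≤ 1 →
    0 ≤ C u₂ v₂ - C u₁ v₂ - C u₂ v₁ + C u₁ v₁

/-- The left end (times `m`) of the grid cell that contains `u ∈ [0,1]`: it is `⌊m u⌋` for `u < 1`
and `m - 1` for `u = 1`. -/
def cell (m : ℕ) (u : ℝ) : ℕ := min ⌊(m : ℝ) * u⌋₊ (m - 1)

/-- The local coordinate of `u` in its grid cell. -/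
def localCoord (m : ℕ) (u : ℝ) : ℝ := m * u - cell m u

/-- The checkerboard operator: bilinear interpolation of `C` on the regular `m × m` grid. -/
def checkerboard (m : ℕ) (C : ℝ → ℝ → ℝ) (u v : ℝ) : ℝ :=
  (1 - localCoord m u) * (1 - localCoord m v) * C (cell m u / m) (cell m v / m)
  + localCoord m u * (1 - localCoord m v) * C ((cell m u + 1) / m) (cell m v / m)
  + (1 - localCoord m u) * localCoord m v * C (cell m u / m) ((cell m v + 1) / m)
  + localCoord m u * localCoord m v * C ((cell m u + 1) / m) ((cell m v + 1) / m)

/-- The rank of `x i` among `x 0, …, x (n-1)`. -/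
def rank (n : ℕ) (x : ℕ → ℝ) (i : ℕ) : ℕ := ((Finset.range n).filter (fun j => x j ≤ x i)).card

/-- The rank-based empirical copula of the sample `(x 0, y 0), …, (x (n-1), y (n-1))`. -/
def empiricalCopula (n : ℕ) (x y : ℕ → ℝ) (u v : ℝ) : ℝ :=
  (((Finset.range n).filter
    (fun i => (rank n x i : ℝ) / n ≤ u ∧ (rank n y i : ℝ) / n ≤ v)).card : ℝ) / n

/-- The extended quadrant `[0,∞]² ∖ {(∞,∞)}`. -/
abbrev ExtQuadrant : Type := {p : ℝ≥0∞ × ℝ≥0∞ // p ≠ (⊤, ⊤)}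

/-- `min (t x) 1` as a real number, for `x ∈ [0,∞]`. Through it a function on `[0,1]²` is evaluated
at `(t x, t y)`: a coordinate beyond `1`, in particular an infinite one, counts as `1`, as usual for
distribution functions of measures on `[0,1]²`. -/
def scaled (t : ℝ) (x : ℝ≥0∞) : ℝ := (min (ENNReal.ofReal t * x) 1).toReal

/-- `C (t x, t y) / t`. -/
def lowerRescaled (C : ℝ → ℝ → ℝ) (t : ℝ) (p : ExtQuadrant) : ℝ :=
  C (scaled t p.1.1) (scaled t p.1.2) / t

/-- `(t x + t y - 1 + C (1 - t x, 1 - t y)) / t`. -/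
def upperRescaled (C : ℝ → ℝ → ℝ) (t : ℝ) (p : ExtQuadrant) : ℝ :=
  (scaled t p.1.1 + scaled t p.1.2 - 1 + C (1 - scaled t p.1.1) (1 - scaled t p.1.2)) / t

/-- `Λ` is the lower tail copula of `C` (and the limit that defines it exists everywhere).
At points with an infinite coordinate this only says `Λ (x, ∞) = x` and `Λ (∞, y) = y`. -/
def IsLowerTailCopula (C : ℝ → ℝ → ℝ) (Λ : ExtQuadrant → ℝ) : Prop :=
  ∀ p, Tendsto (fun t => lowerRescaled C t p) (𝓝[>] 0) (𝓝 (Λ p))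

/-- `Λ` is the upper tail copula of `C` (and the limit that defines it exists everywhere).
At points with an infinite coordinate this only says `Λ (x, ∞) = x` and `Λ (∞, y) = y`. -/
def IsUpperTailCopula (C : ℝ → ℝ → ℝ) (Λ : ExtQuadrant → ℝ) : Prop :=
  ∀ p, Tendsto (fun t => upperRescaled C t p) (𝓝[>] 0) (𝓝 (Λ p))

/-- The raw empirical lower tail copula, `(n/k) Cₙ (k x / n, k y / n)`. -/
def rawLower (n : ℕ) (k : ℝ) (x y : ℕ → ℝ) : ExtQuadrant → ℝ :=
  lowerRescaled (empiricalCopula n x y) (k / n)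

/-- The raw empirical upper tail copula. -/
def rawUpper (n : ℕ) (k : ℝ) (x y : ℕ → ℝ) : ExtQuadrant → ℝ :=
  upperRescaled (empiricalCopula n x y) (k / n)

/-- The checkerboard lower tail copula estimator. -/
def checkerboardLower (n : ℕ) (k : ℝ) (m : ℕ) (x y : ℕ → ℝ) : ExtQuadrant → ℝ :=
  lowerRescaled (checkerboard m (empiricalCopula n x y)) (k / n)

/-- The checkerboard upper tail copula estimator. -/
def checkerboardUpper (n : ℕ) (k : ℝ) (m : ℕ) (x y : ℕ → ℝ) : ExtQuadrant → ℝ :=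
  upperRescaled (checkerboard m (empiricalCopula n x y)) (k / n)

/-- The piece added at step `j + 1` of the exhaustion: with `i = j / 3 + 1` it is, in turn,
`{∞} × [0,i]`, `[0,i] × {∞}` and `[0,i]²`. -/
def piece (j : ℕ) : Set ExtQuadrant :=
  if j % 3 = 0 then {p | p.1.1 = ⊤ ∧ p.1.2 ≤ ((j / 3 + 1 : ℕ) : ℝ≥0∞)}
  else if j % 3 = 1 then {p | p.1.1 ≤ ((j / 3 + 1 : ℕ) : ℝ≥0∞) ∧ p.1.2 = ⊤}
  else {p | p.1.1 ≤ ((j / 3 + 1 : ℕ) : ℝ≥0∞) ∧ p.1.2 ≤ ((j / 3 + 1 : ℕ) : ℝ≥0∞)}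

/-- The exhausting sets `T₀ = ∅ ⊆ T₁ ⊆ T₂ ⊆ …`. -/
def T : ℕ → Set ExtQuadrant
  | 0 => ∅
  | j + 1 => T j ∪ piece j

/-- The space `B_∞` of functions that are bounded on each of the sets `T i`. -/
def BInfty : Set (ExtQuadrant → ℝ) := {f | ∀ i, ∃ M : ℝ, ∀ p ∈ T i, |f p| ≤ M}

/-- The metric of `B_∞`: `d (f, g) = ∑_{i ≥ 1} 2^{-i} (sup_{T i} |f - g| ∧ 1)`. -/
def bDist (f g : ExtQuadrant → ℝ) : ℝ≥0∞ :=
  ∑' i : ℕ, (2 : ℝ≥0∞)⁻¹ ^ (i + 1) * min (⨆ p ∈ T (i + 1), ENNReal.ofReal |f p - g p|) 1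

/-- Convergence of a sequence in the metric space `B_∞`. -/
def ConvergesInBInfty (f : ℕ → ExtQuadrant → ℝ) (g : ExtQuadrant → ℝ) : Prop :=
  (∀ n, f n ∈ BInfty) ∧ g ∈ BInfty ∧ Tendsto (fun n => bDist (f n) g) atTop (𝓝 0)

end CheckerboardTail

end

namespace CheckerboardTail

/-! ### Ranks and the empirical copula of a sample without ties -/

/-! The argument separates a deterministic smoothing error, a stochastic error at fixed points, and
a compactness argument that makes the convergence uniform.

Smoothing. Continuous margins exclude ties almost surely, so the ranks form a permutation of `1, …,
n` and the empirical copula is Lipschitz up to `2 / n`. A checkerboard value is a convex combination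
of values at four corners, each within `1 / m` in both coordinates, hence is off by at most `2 / m +
2 / n`. Division by `k / n` gives the bound for both tails (`abs_checkerboardTail_sub_rawTail_le`),
and this bound tends to zero.

Fixed points. Replacing ranks by `F (X i)` and `G (Y i)` costs only the two marginal deviations plus
`2 / n`, because the index sets compared are initial segments of the same ordering. What remains are
frequencies of events of probability `p` with `p (1 - p) = O(k / n)`, the event being rare or almost
certain. A Chernoff bound that keeps this variance gives a deviation of `ε k / n` probability at
most `2 exp (-c k)`. This is summable once `log n = o(k)`, and Borel–Cantelli applies
(`ae_tendsto_frequency_sub_div`).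

Uniformity. The rescaled functions are Lipschitz up to `O(1 / k)`, and the tail copula is Lipschitz
as a limit of Lipschitz functions. Each `T i` has finite nets once `∞` is treated as an isolated
coordinate, so almost sure convergence at countably many points suffices
(`exists_countable_tendstoUniformlyOn`). -/

lemma rank_lt_rank {n : ℕ} {x : ℕ → ℝ} {i j : ℕ} (hj : j < n) (h : x i < x j) :
    rank n x i < rank n x j := by
  refine Finset.card_lt_card ⟨fun l hl => ?_, fun hs => ?_⟩
  · simp only [Finset.mem_filter] at hl ⊢
    exact ⟨hl.1, hl.2.trans h.le⟩
  · have : j ∈ (Finset.range n).filter (fun l => x l ≤ x i) :=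
      hs (by simp [hj])
    simp only [Finset.mem_filter] at this
    linarith [this.2]

lemma rank_mono {n : ℕ} {x : ℕ → ℝ} {i j : ℕ} (h : x i ≤ x j) : rank n x i ≤ rank n x j := by
  refine Finset.card_le_card fun l hl => ?_
  simp only [Finset.mem_filter] at hl ⊢
  exact ⟨hl.1, hl.2.trans h⟩

lemma image_rank {n : ℕ} {x : ℕ → ℝ} (hx : Set.InjOn x (Finset.range n)) :
    (Finset.range n).image (rank n x) = Finset.Icc 1 n := by
  apply Finset.eq_of_subset_of_card_le
  · intro r hr
    obtain ⟨i, hi, rfl⟩ := Finset.mem_image.1 hr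
    refine Finset.mem_Icc.2 ⟨Finset.card_pos.2 ⟨i, by simpa using hi⟩, ?_⟩
    exact (Finset.card_filter_le _ _).trans (by simp)
  · rw [Finset.card_image_of_injOn]
    · simp
    · intro i hi j hj hij
      apply hx hi hj
      rcases lt_trichotomy (x i) (x j) with h | h | h
      · exact absurd hij (rank_lt_rank (by simpa using hj) h).ne
      · exact h
      · exact absurd hij (rank_lt_rank (by simpa using hi) h).ne'

lemma injOn_rank {n : ℕ} {x : ℕ → ℝ} (hx : Set.InjOn x (Finset.range n)) :
    Set.InjOn (rank n x) (Finset.range n) := by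
  apply Finset.injOn_of_card_image_eq
  rw [image_rank hx]
  simp

/-- The indices of the observations whose normalized rank is at most `u`. -/
noncomputable def rankLE (n : ℕ) (x : ℕ → ℝ) (u : ℝ) : Finset ℕ :=
  (Finset.range n).filter (fun i => (rank n x i : ℝ) / n ≤ u)

/-- Ranks without ties are a permutation of `1, …, n`, so this count does not depend on the data. -/
lemma card_rankLE {n : ℕ} (hn : 1 ≤ n) {x : ℕ → ℝ} (hx : Set.InjOn x (Finset.range n)) {u : ℝ}
    (hu : u ∈ Set.Icc (0 : ℝ) 1) : (rankLE n x u).card = ⌊n * u⌋₊ := by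
  have hn' : (0 : ℝ) < n := by exact_mod_cast hn
  have h0 : 0 ≤ n * u := mul_nonneg hn'.le hu.1
  have h1 : (rankLE n x u).image (rank n x) = Finset.Icc 1 ⌊n * u⌋₊ := by
    have hfl : ⌊n * u⌋₊ ≤ n := by
      have := Nat.floor_le h0
      have h2 : (n : ℝ) * u ≤ n := by nlinarith [hu.2]
      exact_mod_cast this.trans h2
    have : rankLE n x u = (Finset.range n).filter (fun i => rank n x i ≤ ⌊n * u⌋₊) := by
      unfold rankLE
      refine Finset.filter_congr fun i _ => ?_
      rw [div_le_iff₀ hn', Nat.le_floor_iff h0, mul_comm]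
    rw [this, ← Finset.filter_image (p := fun r => r ≤ ⌊n * u⌋₊), image_rank hx]
    ext r
    simp only [Finset.mem_filter, Finset.mem_Icc]
    omega
  rw [← Finset.card_image_of_injOn ((injOn_rank hx).mono (s₁ := rankLE n x u) ?_), h1]
  · simp
  · exact_mod_cast Finset.filter_subset _ _

lemma abs_card_rankLE_sub_le {n : ℕ} (hn : 1 ≤ n) {x : ℕ → ℝ}
    (hx : Set.InjOn x (Finset.range n)) {u : ℝ} (hu : u ∈ Set.Icc (0 : ℝ) 1) (c : ℝ) :
    |((rankLE n x u).card : ℝ) - c| ≤ |n * u - c| + 1 := by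
  rw [card_rankLE hn hx hu]
  have h0 : 0 ≤ n * u := mul_nonneg (Nat.cast_nonneg n) hu.1
  have h1 := Nat.floor_le h0
  have h2 := Nat.lt_floor_add_one (n * u)
  rw [abs_le]
  constructor <;> cases abs_cases (n * u - c) <;> linarith

lemma abs_card_rankLE_sub_card_rankLE_le {n : ℕ} (hn : 1 ≤ n) {x : ℕ → ℝ}
    (hx : Set.InjOn x (Finset.range n)) {u u' : ℝ} (hu : u ∈ Set.Icc (0 : ℝ) 1)
    (hu' : u' ∈ Set.Icc (0 : ℝ) 1) :
    |((rankLE n x u).card : ℝ) - (rankLE n x u').card| ≤ n * |u - u'| + 1 := by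
  rw [card_rankLE hn hx hu, card_rankLE hn hx hu']
  have hn0 : (0 : ℝ) ≤ n := Nat.cast_nonneg n
  have e : n * |u - u'| = |n * u - n * u'| := by rw [← mul_sub, abs_mul, abs_of_nonneg hn0]
  have h1 := Nat.floor_le (mul_nonneg hn0 hu.1)
  have h2 := Nat.lt_floor_add_one (n * u)
  have h3 := Nat.floor_le (mul_nonneg hn0 hu'.1)
  have h4 := Nat.lt_floor_add_one (n * u')
  rw [e, abs_le]
  constructor <;> cases abs_cases (n * u - n * u') <;> linarith

/-- A point of `A ∩ B` outside `A' ∩ B'` lies in `A \ A'` or `B \ B'`. Nestedness is what bounds the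
size of these differences by the difference of cardinalities. -/
lemma card_inter_sub_le {A A' B B' : Finset ℕ} (hA : A ⊆ A' ∨ A' ⊆ A) (hB : B ⊆ B' ∨ B' ⊆ B) :
    ((A ∩ B).card : ℝ) - (A' ∩ B').card ≤
      |(A.card : ℝ) - A'.card| + |(B.card : ℝ) - B'.card| := by
  have hsd : ∀ {S S' : Finset ℕ}, (S ⊆ S' ∨ S' ⊆ S) →
      ((S \ S').card : ℝ) ≤ |(S.card : ℝ) - S'.card| := by
    rintro S S' (h | h)
    · simp [Finset.sdiff_eq_empty_iff_subset.2 h]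
    · rw [Finset.cast_card_sdiff h]
      exact le_abs_self _
  have h1 : A ∩ B ⊆ (A' ∩ B') ∪ ((A \ A') ∪ (B \ B')) := by
    intro i hi
    simp only [Finset.mem_union, Finset.mem_inter, Finset.mem_sdiff] at hi ⊢
    tauto
  have h2 : (A ∩ B).card ≤ (A' ∩ B').card + ((A \ A').card + (B \ B').card) :=
    (Finset.card_le_card h1).trans <| (Finset.card_union_le _ _).trans <| by
      gcongr
      exact Finset.card_union_le _ _
  have h3 : ((A ∩ B).card : ℝ) ≤ (A' ∩ B').card + ((A \ A').card + (B \ B').card) := by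
    exact_mod_cast h2
  linarith [hsd hA, hsd hB]

lemma abs_card_inter_sub_le {A A' B B' : Finset ℕ} (hA : A ⊆ A' ∨ A' ⊆ A)
    (hB : B ⊆ B' ∨ B' ⊆ B) :
    |((A ∩ B).card : ℝ) - (A' ∩ B').card| ≤
      |(A.card : ℝ) - A'.card| + |(B.card : ℝ) - B'.card| := by
  refine abs_sub_le_iff.2 ⟨card_inter_sub_le hA hB, ?_⟩
  rw [abs_sub_comm (A.card : ℝ), abs_sub_comm (B.card : ℝ)]
  exact card_inter_sub_le hA.symm hB.symm

lemma empiricalCopula_eq (n : ℕ) (x y : ℕ → ℝ) (u v : ℝ) :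
    empiricalCopula n x y u v = ((rankLE n x u ∩ rankLE n y v).card : ℝ) / n := by
  rw [empiricalCopula, rankLE, rankLE, Finset.filter_and]

lemma empiricalCopula_mem_Icc (n : ℕ) (x y : ℕ → ℝ) (u v : ℝ) :
    empiricalCopula n x y u v ∈ Set.Icc (0 : ℝ) 1 := by
  refine ⟨by unfold empiricalCopula; positivity, div_le_one_of_le₀ ?_ (by positivity)⟩
  exact_mod_cast (Finset.card_filter_le _ _).trans (by simp)

lemma rankLE_subset_total (n : ℕ) (x : ℕ → ℝ) (u u' : ℝ) :
    rankLE n x u ⊆ rankLE n x u' ∨ rankLE n x u' ⊆ rankLE n x u := by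
  rcases le_total u u' with h | h
  · exact Or.inl (Finset.monotone_filter_right _ fun i _ hi => hi.trans h)
  · exact Or.inr (Finset.monotone_filter_right _ fun i _ hi => hi.trans h)

lemma abs_empiricalCopula_sub_le {n : ℕ} (hn : 1 ≤ n) {x y : ℕ → ℝ}
    (hx : Set.InjOn x (Finset.range n)) (hy : Set.InjOn y (Finset.range n)) {u u' v v' : ℝ}
    (hu : u ∈ Set.Icc (0 : ℝ) 1) (hu' : u' ∈ Set.Icc (0 : ℝ) 1) (hv : v ∈ Set.Icc (0 : ℝ) 1)
    (hv' : v' ∈ Set.Icc (0 : ℝ) 1) :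
    |empiricalCopula n x y u v - empiricalCopula n x y u' v'| ≤ |u - u'| + |v - v'| + 2 / n := by
  have hn' : (0 : ℝ) < n := by exact_mod_cast hn
  rw [empiricalCopula_eq, empiricalCopula_eq, ← sub_div, abs_div, abs_of_pos hn', div_le_iff₀ hn']
  have h1 := abs_card_inter_sub_le (rankLE_subset_total n x u u') (rankLE_subset_total n y v v')
  have h2 := abs_card_rankLE_sub_card_rankLE_le hn hx hu hu'
  have h3 := abs_card_rankLE_sub_card_rankLE_le hn hy hv hv'
  have h4 : (|u - u'| + |v - v'| + 2 / n) * n = n * |u - u'| + n * |v - v'| + 2 := by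
    field_simp
  linarith

/-- The indices of the observations with `f (x i) ≤ u`. -/
noncomputable def valueLE (n : ℕ) (f : ℝ → ℝ) (x : ℕ → ℝ) (u : ℝ) : Finset ℕ :=
  (Finset.range n).filter (fun i => f (x i) ≤ u)

/-- The joint empirical distribution function of the transformed sample `(f (x i), g (y i))`. -/
noncomputable def empiricalCDF (n : ℕ) (f g : ℝ → ℝ) (x y : ℕ → ℝ) (u v : ℝ) : ℝ :=
  (((Finset.range n).filter (fun i => f (x i) ≤ u ∧ g (y i) ≤ v)).card : ℝ) / n

lemma empiricalCDF_eq (n : ℕ) (f g : ℝ → ℝ) (x y : ℕ → ℝ) (u v : ℝ) :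
    empiricalCDF n f g x y u v = ((valueLE n f x u ∩ valueLE n g y v).card : ℝ) / n := by
  rw [empiricalCDF, valueLE, valueLE, Finset.filter_and]

/-- The rank and `f ∘ x` are both monotone in the observation, so both sets are cut off from below
along the same ordering of the sample. -/
lemma rankLE_valueLE_total (n : ℕ) {f : ℝ → ℝ} (hf : Monotone f) (x : ℕ → ℝ) (u : ℝ) :
    rankLE n x u ⊆ valueLE n f x u ∨ valueLE n f x u ⊆ rankLE n x u := by
  by_contra! h
  obtain ⟨⟨i, hi, hi'⟩, ⟨j, hj, hj'⟩⟩ :=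
    (And.intro (Finset.not_subset.1 h.1) (Finset.not_subset.1 h.2))
  simp only [rankLE, valueLE, Finset.mem_filter, not_and, not_le] at hi hi' hj hj'
  rcases le_total (x i) (x j) with hij | hij
  · exact absurd ((hf hij).trans hj.2) (not_le.2 (hi' hi.1))
  · have h1 : (rank n x j : ℝ) / n ≤ (rank n x i : ℝ) / n := by
      have := rank_mono (n := n) hij
      gcongr
    exact absurd (h1.trans hi.2) (not_le.2 (hj' hj.1))

lemma abs_empiricalCopula_sub_empiricalCDF_le {n : ℕ} (hn : 1 ≤ n) {f g : ℝ → ℝ}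
    (hf : Monotone f) (hg : Monotone g) (hf1 : ∀ a, f a ≤ 1) (hg1 : ∀ a, g a ≤ 1) {x y : ℕ → ℝ}
    (hx : Set.InjOn x (Finset.range n)) (hy : Set.InjOn y (Finset.range n)) {u v : ℝ}
    (hu : u ∈ Set.Icc (0 : ℝ) 1) (hv : v ∈ Set.Icc (0 : ℝ) 1) :
    |empiricalCopula n x y u v - empiricalCDF n f g x y u v| ≤
      |empiricalCDF n f g x y u 1 - u| + |empiricalCDF n f g x y 1 v - v| + 2 / n := by
  have hn' : (0 : ℝ) < n := by exact_mod_cast hn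
  -- Since `f` and `g` are at most `1`, the argument `1` imposes no constraint and leaves a
  -- marginal.
  have e1 : empiricalCDF n f g x y u 1 = ((valueLE n f x u).card : ℝ) / n := by
    simp [empiricalCDF, valueLE, hg1]
  have e2 : empiricalCDF n f g x y 1 v = ((valueLE n g y v).card : ℝ) / n := by
    simp [empiricalCDF, valueLE, hf1]
  rw [e1, e2, empiricalCopula_eq, empiricalCDF_eq, ← sub_div, abs_div, abs_of_pos hn',
    div_le_iff₀ hn']
  have h1 := abs_card_inter_sub_le (rankLE_valueLE_total n hf x u) (rankLE_valueLE_total n hg y v)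
  have h2 := abs_card_rankLE_sub_le hn hx hu (valueLE n f x u).card
  have h3 := abs_card_rankLE_sub_le hn hy hv (valueLE n g y v).card
  have key : ∀ c w : ℝ, |n * w - c| = |c / n - w| * n := fun c w => by
    rw [← abs_of_pos hn', ← abs_mul, abs_of_pos hn', abs_sub_comm]
    congr 1
    field_simp
  rw [key] at h2 h3
  have h4 : (2 : ℝ) / n * n = 2 := by field_simp
  nlinarith

/-! ### The checkerboard error -/

lemma cell_le {m : ℕ} {u : ℝ} (hu : 0 ≤ u) : (cell m u : ℝ) ≤ m * u :=
  (Nat.cast_le.2 (min_le_left _ _)).trans (Nat.floor_le (by positivity))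

lemma cell_add_one_le {m : ℕ} (hm : 1 ≤ m) (u : ℝ) : (cell m u : ℝ) + 1 ≤ m := by
  have : cell m u + 1 ≤ m := by
    have := min_le_right ⌊(m : ℝ) * u⌋₊ (m - 1)
    unfold cell
    omega
  exact_mod_cast this

lemma le_cell_add_one {m : ℕ} (hm : 1 ≤ m) {u : ℝ} (hu : u ≤ 1) :
    (m : ℝ) * u ≤ cell m u + 1 := by
  have hm' : (1 : ℝ) ≤ m := by exact_mod_cast hm
  unfold cell
  rcases min_choice ⌊(m : ℝ) * u⌋₊ (m - 1) with h | h <;> rw [h]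
  · exact (Nat.lt_floor_add_one _).le
  · rw [Nat.cast_sub hm]
    push_cast
    nlinarith

lemma localCoord_mem_Icc {m : ℕ} (hm : 1 ≤ m) {u : ℝ} (hu : u ∈ Set.Icc (0 : ℝ) 1) :
    localCoord m u ∈ Set.Icc (0 : ℝ) 1 := by
  unfold localCoord
  exact ⟨by linarith [cell_le (m := m) hu.1], by linarith [le_cell_add_one hm hu.2]⟩

/-- The four weights are nonnegative and sum to one. -/
lemma abs_bilinear_sub_le {a b c₁ c₂ c₃ c₄ c r : ℝ} (ha : a ∈ Set.Icc (0 : ℝ) 1)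
    (hb : b ∈ Set.Icc (0 : ℝ) 1) (h₁ : |c₁ - c| ≤ r) (h₂ : |c₂ - c| ≤ r) (h₃ : |c₃ - c| ≤ r)
    (h₄ : |c₄ - c| ≤ r) :
    |(1 - a) * (1 - b) * c₁ + a * (1 - b) * c₂ + (1 - a) * b * c₃ + a * b * c₄ - c| ≤ r := by
  obtain ⟨ha0, ha1⟩ := ha
  obtain ⟨hb0, hb1⟩ := hb
  have ha1' := sub_nonneg.2 ha1
  have hb1' := sub_nonneg.2 hb1
  rw [abs_le] at *
  have w₁ := mul_nonneg ha1' hb1'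
  have w₂ := mul_nonneg ha0 hb1'
  have w₃ := mul_nonneg ha1' hb0
  have w₄ := mul_nonneg ha0 hb0
  constructor
  · linarith [mul_le_mul_of_nonneg_left h₁.1 w₁, mul_le_mul_of_nonneg_left h₂.1 w₂,
      mul_le_mul_of_nonneg_left h₃.1 w₃, mul_le_mul_of_nonneg_left h₄.1 w₄]
  · linarith [mul_le_mul_of_nonneg_left h₁.2 w₁, mul_le_mul_of_nonneg_left h₂.2 w₂,
      mul_le_mul_of_nonneg_left h₃.2 w₃, mul_le_mul_of_nonneg_left h₄.2 w₄]

lemma abs_checkerboard_sub_le {m : ℕ} (hm : 1 ≤ m) {D : ℝ → ℝ → ℝ} {δ : ℝ}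
    (hD : ∀ u ∈ Set.Icc (0 : ℝ) 1, ∀ u' ∈ Set.Icc (0 : ℝ) 1, ∀ v ∈ Set.Icc (0 : ℝ) 1,
      ∀ v' ∈ Set.Icc (0 : ℝ) 1, |D u v - D u' v'| ≤ |u - u'| + |v - v'| + δ) {u v : ℝ}
    (hu : u ∈ Set.Icc (0 : ℝ) 1) (hv : v ∈ Set.Icc (0 : ℝ) 1) :
    |checkerboard m D u v - D u v| ≤ 2 / m + δ := by
  have hm' : (0 : ℝ) < m := by exact_mod_cast hm
  have corner : ∀ w ∈ Set.Icc (0 : ℝ) 1,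
      ((cell m w : ℝ) / m ∈ Set.Icc (0 : ℝ) 1 ∧ |(cell m w : ℝ) / m - w| ≤ 1 / m) ∧
      (((cell m w : ℝ) + 1) / m ∈ Set.Icc (0 : ℝ) 1 ∧ |((cell m w : ℝ) + 1) / m - w| ≤ 1 / m) := by
    intro w hw
    have h1 := cell_le (m := m) hw.1
    have h2 := cell_add_one_le hm w
    have h3 := le_cell_add_one hm hw.2
    have e1 : (cell m w : ℝ) / m - w = (cell m w - m * w) / m := by field_simp
    have e2 : ((cell m w : ℝ) + 1) / m - w = (cell m w + 1 - m * w) / m := by field_simp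
    refine ⟨⟨⟨by positivity, by rw [div_le_one hm']; linarith⟩, ?_⟩,
      ⟨⟨by positivity, by rw [div_le_one hm']; linarith⟩, ?_⟩⟩
    · rw [e1, abs_div, abs_of_pos hm']
      gcongr
      rw [abs_le]
      constructor <;> linarith
    · rw [e2, abs_div, abs_of_pos hm']
      gcongr
      rw [abs_le]
      constructor <;> linarith
  obtain ⟨⟨a1, a2⟩, a3, a4⟩ := corner u hu
  obtain ⟨⟨b1, b2⟩, b3, b4⟩ := corner v hv
  have e : (2 : ℝ) / m = 1 / m + 1 / m := by ring
  exact abs_bilinear_sub_le (localCoord_mem_Icc hm hu) (localCoord_mem_Icc hm hv)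
    ((hD _ a1 _ hu _ b1 _ hv).trans (by linarith)) ((hD _ a3 _ hu _ b1 _ hv).trans (by linarith))
    ((hD _ a1 _ hu _ b3 _ hv).trans (by linarith)) ((hD _ a3 _ hu _ b3 _ hv).trans (by linarith))

lemma abs_checkerboard_le {m : ℕ} (hm : 1 ≤ m) {D : ℝ → ℝ → ℝ} {r : ℝ} (hD : ∀ u v, |D u v| ≤ r)
    {u v : ℝ} (hu : u ∈ Set.Icc (0 : ℝ) 1) (hv : v ∈ Set.Icc (0 : ℝ) 1) :
    |checkerboard m D u v| ≤ r := by
  have := abs_bilinear_sub_le (c := 0) (localCoord_mem_Icc hm hu) (localCoord_mem_Icc hm hv)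
    (by simpa using hD (cell m u / m) (cell m v / m))
    (by simpa using hD ((cell m u + 1) / m) (cell m v / m))
    (by simpa using hD (cell m u / m) ((cell m v + 1) / m))
    (by simpa using hD ((cell m u + 1) / m) ((cell m v + 1) / m))
  simpa [checkerboard] using this

lemma scaled_mem_Icc (t : ℝ) (x : ℝ≥0∞) : scaled t x ∈ Set.Icc (0 : ℝ) 1 := by
  refine ⟨ENNReal.toReal_nonneg, ?_⟩
  unfold scaled
  exact (ENNReal.toReal_mono ENNReal.one_ne_top (min_le_right _ _)).trans_eq ENNReal.toReal_one

lemma one_sub_mem_Icc {s : ℝ} (hs : s ∈ Set.Icc (0 : ℝ) 1) : 1 - s ∈ Set.Icc (0 : ℝ) 1 :=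
  ⟨by linarith [hs.2], by linarith [hs.1]⟩

/-- The linear terms cancel, so errors in the upper tail are errors of `D` at the reflected point.
-/
lemma upperRescaled_sub_upperRescaled (D D' : ℝ → ℝ → ℝ) (t : ℝ) (p : ExtQuadrant) :
    upperRescaled D t p - upperRescaled D' t p =
      (D (1 - scaled t p.1.1) (1 - scaled t p.1.2)
        - D' (1 - scaled t p.1.1) (1 - scaled t p.1.2)) / t := by
  unfold upperRescaled
  ring

lemma lowerRescaled_sub_lowerRescaled (D D' : ℝ → ℝ → ℝ) (t : ℝ) (p : ExtQuadrant) :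
    lowerRescaled D t p - lowerRescaled D' t p =
      (D (scaled t p.1.1) (scaled t p.1.2) - D' (scaled t p.1.1) (scaled t p.1.2)) / t := by
  unfold lowerRescaled
  ring

lemma abs_checkerboardTail_sub_rawTail_le {n m : ℕ} {k : ℝ} (hn : 1 ≤ n) (hm : 1 ≤ m) (hk : 0 < k)
    {x y : ℕ → ℝ} (hx : Set.InjOn x (Finset.range n)) (hy : Set.InjOn y (Finset.range n))
    (p : ExtQuadrant) :
    |checkerboardLower n k m x y p - rawLower n k x y p| ≤ 2 * n / (k * m) + 2 / k ∧
    |checkerboardUpper n k m x y p - rawUpper n k x y p| ≤ 2 * n / (k * m) + 2 / k := by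
  have hn' : (0 : ℝ) < n := by exact_mod_cast hn
  have hm' : (0 : ℝ) < m := by exact_mod_cast hm
  have ht : 0 < k / n := div_pos hk hn'
  have e : (2 * n / (k * m) + 2 / k) * (k / n) = 2 / m + 2 / n := by
    field_simp
  have main : ∀ u ∈ Set.Icc (0 : ℝ) 1, ∀ v ∈ Set.Icc (0 : ℝ) 1,
      |(checkerboard m (empiricalCopula n x y) u v - empiricalCopula n x y u v) / (k / n)| ≤
        2 * n / (k * m) + 2 / k := by
    intro u hu v hv
    rw [abs_div, abs_of_pos ht, div_le_iff₀ ht, e]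
    exact abs_checkerboard_sub_le hm (fun u hu u' hu' v hv v' hv' =>
      abs_empiricalCopula_sub_le hn hx hy hu hu' hv hv') hu hv
  constructor
  · rw [checkerboardLower, rawLower, lowerRescaled_sub_lowerRescaled]
    exact main _ (scaled_mem_Icc _ _) _ (scaled_mem_Icc _ _)
  · rw [checkerboardUpper, rawUpper, upperRescaled_sub_upperRescaled]
    exact main _ (one_sub_mem_Icc (scaled_mem_Icc _ _)) _ (one_sub_mem_Icc (scaled_mem_Icc _ _))

/-! ### An exponential inequality for frequencies of rare (or almost certain) events -/

section Concentration

variable {Ω : Type*} [MeasurableSpace Ω] {P : Measure Ω} [IsProbabilityMeasure P]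

/-- From `exp z ≤ 1 + z + z ^ 2` for `|z| ≤ 1`, the centred linear term integrates to zero and the
square to the variance. A Hoeffding bound would lose the factor `p (1 - p)`, which carries the small
scale `k / n`. -/
lemma mgf_indicator_sub_le {E : Set Ω} (hE : MeasurableSet E) {l : ℝ} (hl : |l| ≤ 1) :
    mgf (fun ω => E.indicator (fun _ => (1 : ℝ)) ω - P.real E) P l ≤
      Real.exp (l ^ 2 * (P.real E * (1 - P.real E))) := by
  set p := P.real E with hp
  have hp0 : 0 ≤ p := measureReal_nonneg
  have hp1 : p ≤ 1 := measureReal_le_one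
  have hint : Integrable (E.indicator (fun _ => (1 : ℝ))) P :=
    (integrable_const 1).indicator hE
  have hval : ∫ ω, E.indicator (fun _ => (1 : ℝ)) ω ∂P = p := by
    rw [integral_indicator hE]
    simp [hp]
  -- The right side is the affine function of the indicator that equals `1 + l z + (l z) ^ 2` at its
  -- two values `z = 1 - p` and `z = -p`.
  have hpt : ∀ ω, Real.exp (l * (E.indicator (fun _ => (1 : ℝ)) ω - p)) ≤
      (1 - l * p + l ^ 2 * p ^ 2) + (l + l ^ 2 * (1 - 2 * p)) *
        E.indicator (fun _ => (1 : ℝ)) ω := by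
    intro ω
    have key : ∀ z : ℝ, |z| ≤ 1 → Real.exp (l * z) ≤ 1 + l * z + (l * z) ^ 2 := by
      intro z hz
      have h1 : |l * z| ≤ 1 := by
        rw [abs_mul]
        exact mul_le_one₀ hl (abs_nonneg _) hz
      have := (abs_le.1 (Real.abs_exp_sub_one_sub_id_le h1)).2
      linarith
    by_cases h : ω ∈ E
    · simp only [h, Set.indicator_of_mem]
      refine (key _ (by rw [abs_le]; constructor <;> linarith)).trans (le_of_eq (by ring))
    · simp only [h, Set.indicator_of_notMem, not_false_eq_true]
      refine (key _ (by rw [abs_le]; constructor <;> linarith)).trans (le_of_eq (by ring))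
  have hint2 : Integrable (fun ω => (1 - l * p + l ^ 2 * p ^ 2) + (l + l ^ 2 * (1 - 2 * p)) *
        E.indicator (fun _ => (1 : ℝ)) ω) P :=
    (integrable_const _).add (hint.const_mul _)
  calc mgf (fun ω => E.indicator (fun _ => (1 : ℝ)) ω - p) P l
      ≤ ∫ ω, ((1 - l * p + l ^ 2 * p ^ 2) + (l + l ^ 2 * (1 - 2 * p)) *
        E.indicator (fun _ => (1 : ℝ)) ω) ∂P :=
        integral_mono_of_nonneg (ae_of_all _ fun ω => (Real.exp_pos _).le) hint2 (ae_of_all _ hpt)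
    _ = l ^ 2 * (p * (1 - p)) + 1 := by
        rw [integral_add (integrable_const _) (hint.const_mul _), integral_const_mul, hval]
        simp
        ring
    _ ≤ _ := Real.add_one_le_exp _

variable {S : Type*} [MeasurableSpace S] {W : ℕ → Ω → S}

open Classical in
/-- The relative frequency of `A` among `w 0, …, w (n - 1)`. -/
noncomputable def frequency (n : ℕ) (w : ℕ → S) (A : Set S) : ℝ :=
  (((Finset.range n).filter (fun i => w i ∈ A)).card : ℝ) / n

/-- Chernoff's method with parameters `l` and `-l`, one for each side. The parameter stays free so
that it can later be matched to the deviation. -/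
lemma measureReal_abs_frequency_sub_ge_le (hW : ∀ i, Measurable (W i)) (hindep : iIndepFun W P)
    (hident : ∀ i, IdentDistrib (W i) (W 0) P P) {A : Set S} (hA : MeasurableSet A) {p : ℝ}
    (hp : P.real (W 0 ⁻¹' A) = p) {l : ℝ} (hl0 : 0 ≤ l) (hl1 : l ≤ 1) {n : ℕ} (hn : 1 ≤ n)
    (a : ℝ) :
    P.real {ω | a ≤ |frequency n (fun i => W i ω) A - p|} ≤
      2 * Real.exp (n * (l ^ 2 * (p * (1 - p))) - l * (n * a)) := by
  have hn' : (0 : ℝ) < n := by exact_mod_cast hn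
  have hpi : ∀ i, P.real (W i ⁻¹' A) = p := fun i => by
    rw [← hp, measureReal_def, measureReal_def, (hident i).measure_mem_eq hA]
  let Z : ℕ → Ω → ℝ := fun i ω => (W i ⁻¹' A).indicator (fun _ => (1 : ℝ)) ω - p
  have hφ : Measurable (fun s : S => A.indicator (fun _ => (1 : ℝ)) s - p) :=
    (measurable_const.indicator hA).sub_const _
  have hZm : ∀ i, Measurable (Z i) := fun i => hφ.comp (hW i)
  have hZi : iIndepFun Z P := hindep.comp (fun _ s => A.indicator (fun _ => (1 : ℝ)) s - p)
    (fun _ => hφ)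
  have hp0 : 0 ≤ p := hp ▸ measureReal_nonneg
  have hp1 : p ≤ 1 := hp ▸ measureReal_le_one
  have hmgf : ∀ l' : ℝ, |l'| ≤ 1 → mgf (∑ i ∈ Finset.range n, Z i) P l' ≤
      Real.exp (n * (l' ^ 2 * (p * (1 - p)))) := by
    intro l' hl'
    rw [hZi.mgf_sum hZm]
    calc ∏ i ∈ Finset.range n, mgf (Z i) P l'
        ≤ ∏ i ∈ Finset.range n, Real.exp (l' ^ 2 * (p * (1 - p))) := by
          refine Finset.prod_le_prod (fun i _ => mgf_nonneg) fun i _ => ?_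
          have := mgf_indicator_sub_le (P := P) (hW i hA) hl'
          rwa [hpi i] at this
      _ = _ := by rw [Finset.prod_const, Finset.card_range, ← Real.exp_nat_mul]
  have hsum : ∀ ω, (∑ i ∈ Finset.range n, Z i) ω =
      n * (frequency n (fun i => W i ω) A - p) := by
    intro ω
    classical
    have : ∀ i, Z i ω = (if W i ω ∈ A then (1 : ℝ) else 0) - p := fun i => by
      simp only [Z, Set.indicator_apply, Set.mem_preimage]
    rw [Finset.sum_apply, Finset.sum_congr rfl fun i _ => this i, Finset.sum_sub_distrib,
      Finset.sum_boole, frequency]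
    simp
    field_simp
  have hexp : ∀ l' : ℝ, Integrable (fun ω => Real.exp (l' * (∑ i ∈ Finset.range n, Z i) ω)) P := by
    intro l'
    have hm : Measurable (∑ i ∈ Finset.range n, Z i) := by
      have h := Finset.measurable_sum (Finset.range n) fun i _ => hZm i
      simpa only [← Finset.sum_apply] using h
    refine Integrable.of_bound (C := Real.exp (|l'| * n))
      (by fun_prop) (ae_of_all _ fun ω => ?_)
    rw [Real.norm_eq_abs, Real.abs_exp]
    refine Real.exp_le_exp.2 ((le_abs_self _).trans ?_)
    rw [abs_mul]
    gcongr
    rw [Finset.sum_apply]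
    refine (Finset.abs_sum_le_sum_abs _ _).trans ?_
    calc ∑ i ∈ Finset.range n, |Z i ω| ≤ ∑ i ∈ Finset.range n, (1 : ℝ) := by
          refine Finset.sum_le_sum fun i _ => ?_
          by_cases h : ω ∈ W i ⁻¹' A <;>
            simp only [Z, h, Set.indicator_of_mem, Set.indicator_of_notMem, not_false_eq_true] <;>
            rw [abs_le] <;> constructor <;> linarith
      _ = n := by simp
  have hup := measure_ge_le_exp_mul_mgf (n * a) hl0 (hexp l)
  have hlo := measure_le_le_exp_mul_mgf (-(n * a)) (neg_nonpos.2 hl0) (hexp (-l))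
  have hsub : {ω | a ≤ |frequency n (fun i => W i ω) A - p|} ⊆
      {ω | n * a ≤ (∑ i ∈ Finset.range n, Z i) ω} ∪
      {ω | (∑ i ∈ Finset.range n, Z i) ω ≤ -(n * a)} := by
    intro ω hω
    simp only [Set.mem_ofPred_eq, Set.mem_union, hsum] at hω ⊢
    rcases le_abs.1 hω with h | h
    · left; gcongr
    · right; nlinarith
  have habs : |l| ≤ 1 := by rwa [abs_of_nonneg hl0]
  calc P.real {ω | a ≤ |frequency n (fun i => W i ω) A - p|}
      ≤ P.real {ω | n * a ≤ (∑ i ∈ Finset.range n, Z i) ω} +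
        P.real {ω | (∑ i ∈ Finset.range n, Z i) ω ≤ -(n * a)} :=
        (measureReal_mono hsub).trans (measureReal_union_le _ _)
    _ ≤ Real.exp (-l * (n * a)) * Real.exp (n * (l ^ 2 * (p * (1 - p)))) +
        Real.exp (-(-l) * -(n * a)) * Real.exp (n * ((-l) ^ 2 * (p * (1 - p)))) := by
        refine add_le_add (hup.trans ?_) (hlo.trans ?_)
        · gcongr; exact hmgf l habs
        · gcongr; exact hmgf (-l) (by rwa [abs_neg])
    _ = _ := by
        rw [← Real.exp_add, ← Real.exp_add, two_mul]
        congr 2 <;> ring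

lemma ae_tendsto_frequency_sub_div (hW : ∀ i, Measurable (W i)) (hindep : iIndepFun W P)
    (hident : ∀ i, IdentDistrib (W i) (W 0) P P) {k : ℕ → ℝ} (hk : ∀ n, 1 ≤ n → 0 < k n)
    (hklog : (fun n : ℕ => Real.log n) =o[atTop] k)
    {A : ℕ → Set S} (hA : ∀ n, MeasurableSet (A n)) {p : ℕ → ℝ}
    (hp : ∀ n, P.real (W 0 ⁻¹' A n) = p n) {B : ℝ}
    (hB : ∀ n, 1 ≤ n → p n * (1 - p n) ≤ B * (k n / n)) :
    ∀ᵐ ω ∂P, Tendsto (fun n : ℕ => (frequency n (fun i => W i ω) (A n) - p n) / (k n / n))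
      atTop (𝓝 0) := by
  -- Only the tolerances `1 / (j + 1)` are treated, so that the exceptional null sets are countably
  -- many.
  have main : ∀ j : ℕ, ∀ᵐ ω ∂P, ∀ᶠ n : ℕ in atTop,
      |frequency n (fun i => W i ω) (A n) - p n| < 1 / ((j : ℝ) + 1) * (k n / n) := by
    intro j
    set ε : ℝ := 1 / ((j : ℝ) + 1) with hε
    have hε0 : 0 < ε := by positivity
    set B' := max B 1
    have hB' : 0 < B' := lt_max_of_lt_right one_pos
    -- With this `l` the quadratic term of the exponent is at most half of the linear term `l ε k`,
    -- which leaves `-c k` with `c = l ε / 2`.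
    set l := min 1 (ε / (2 * B')) with hl
    have hl0 : 0 < l := lt_min one_pos (by positivity)
    have hl1 : l ≤ 1 := min_le_left _ _
    have hlB : l * B' ≤ ε / 2 := by
      calc l * B' ≤ ε / (2 * B') * B' := by gcongr; exact min_le_right _ _
        _ = ε / 2 := by field_simp
    set c := l * ε / 2 with hc
    have hc0 : 0 < c := by positivity
    set E : ℕ → Set Ω := fun n =>
      {ω | ε * (k n / n) ≤ |frequency n (fun i => W i ω) (A n) - p n|} with hE
    have hbound : ∀ n, 1 ≤ n → P.real (E n) ≤ 2 * Real.exp (-(c * k n)) := by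
      intro n hn
      have hn' : (0 : ℝ) < n := by exact_mod_cast hn
      refine (measureReal_abs_frequency_sub_ge_le hW hindep hident (hA n) (hp n) hl0.le hl1 hn
        _).trans ?_
      gcongr
      have h1 : p n * (1 - p n) ≤ B' * (k n / n) :=
        (hB n hn).trans (mul_le_mul_of_nonneg_right (le_max_left _ _)
          (div_nonneg (hk n hn).le hn'.le))
      have h2 : (n : ℝ) * (l ^ 2 * (p n * (1 - p n))) ≤ l * (l * B') * k n := by
        calc (n : ℝ) * (l ^ 2 * (p n * (1 - p n))) ≤ n * (l ^ 2 * (B' * (k n / n))) := by gcongr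
          _ = _ := by field_simp
      have h3 : l * (l * B') * k n ≤ l * (ε / 2) * k n := by
        have := (hk n hn).le
        gcongr
      have h4 : l * (n * (ε * (k n / n))) = l * ε * k n := by field_simp
      rw [h4, hc]
      linarith
    have hsummable : Summable fun n => P.real (E n) := by
      refine Summable.of_norm_bounded_eventually_nat (g := fun n : ℕ => 2 * (1 / (n : ℝ) ^ 2))
        ((Real.summable_one_div_nat_pow.2 one_lt_two).mul_left 2) ?_
      -- Eventually `2 log n ≤ c k`, so `exp (-c k) ≤ 1 / n ^ 2`.
      filter_upwards [hklog.bound (half_pos hc0), eventually_ge_atTop 1] with n hlog hn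
      have hn' : (0 : ℝ) < n := by exact_mod_cast hn
      rw [Real.norm_of_nonneg measureReal_nonneg]
      refine (hbound n hn).trans ?_
      gcongr
      rw [Real.norm_eq_abs, Real.norm_eq_abs, abs_of_pos (hk n hn)] at hlog
      have h1 := (le_abs_self _).trans hlog
      calc Real.exp (-(c * k n)) ≤ Real.exp (-(Real.log n + Real.log n)) :=
            Real.exp_le_exp.2 (by linarith)
        _ = 1 / (n : ℝ) ^ 2 := by
            rw [Real.exp_neg, Real.exp_add, Real.exp_log hn', one_div, sq]
    have hfin : ∑' n, P (E n) ≠ ∞ := by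
      have : ∀ n, P (E n) = ENNReal.ofReal (P.real (E n)) := fun n => by simp
      simp_rw [this]
      exact hsummable.tsum_ofReal_ne_top
    filter_upwards [ae_eventually_notMem hfin] with ω hω
    filter_upwards [hω] with n hn
    simpa [hE] using hn
  filter_upwards [ae_all_iff.2 main] with ω hω
  rw [Metric.tendsto_nhds]
  intro ε hε
  obtain ⟨j, hj⟩ := exists_nat_one_div_lt hε
  filter_upwards [hω j, eventually_ge_atTop 1] with n hn hn1
  have ht : 0 < k n / n := div_pos (hk n hn1) (by exact_mod_cast hn1)
  rw [Real.dist_eq, sub_zero, abs_div, abs_of_pos ht, div_lt_iff₀ ht]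
  exact hn.trans (mul_lt_mul_of_pos_right hj ht)

end Concentration

/-! ### Continuous marginals -/

/-- The largest solution of `F x = u` is taken, so that `{F ≤ u}` is exactly a half-line even where
`F` is flat. If `F` were below `u` at the supremum, continuity would extend the set further right.
-/
lemma exists_quantile {F : ℝ → ℝ} (hF : Continuous F) (hmono : Monotone F)
    (hbot : Tendsto F atBot (𝓝 0)) (htop : Tendsto F atTop (𝓝 1)) {u : ℝ}
    (hu : u ∈ Set.Ioo (0 : ℝ) 1) :
    ∃ x, F x = u ∧ ∀ a, F a ≤ u ↔ a ≤ x := by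
  set S : Set ℝ := {a | F a ≤ u} with hS
  have hne : S.Nonempty := (hbot.eventually (gt_mem_nhds hu.1)).exists.imp fun a ha => le_of_lt ha
  have hbdd : BddAbove S := by
    obtain ⟨b, hb⟩ := (htop.eventually (lt_mem_nhds hu.2)).exists
    refine ⟨b, fun a ha => ?_⟩
    by_contra! h
    exact absurd ((hmono h.le).trans ha) (not_le.2 hb)
  have hmem : sSup S ∈ S := (isClosed_le hF continuous_const).csSup_mem hne hbdd
  refine ⟨sSup S, le_antisymm hmem ?_, fun a => ⟨fun ha => le_csSup hbdd ha,
    fun ha => (hmono ha).trans hmem⟩⟩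
  by_contra! h
  have h1 : ∀ᶠ b in 𝓝[>] (sSup S), F b < u :=
    (hF.continuousAt.eventually (gt_mem_nhds h)).filter_mono nhdsWithin_le_nhds
  obtain ⟨b, hb, hb'⟩ := (h1.and self_mem_nhdsWithin).exists
  exact absurd (le_csSup hbdd (show b ∈ S from hb.le)) (not_le.2 hb')

section Marginals

variable {Ω : Type*} [MeasurableSpace Ω] {P : Measure Ω} [IsProbabilityMeasure P]

lemma measureReal_cdf_comp_le {X : Ω → ℝ} (hX : Measurable X)
    (hF : Continuous (cdf (P.map X))) {u : ℝ} (hu : u ∈ Set.Icc (0 : ℝ) 1) :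
    P.real {ω | cdf (P.map X) (X ω) ≤ u} = u := by
  have : IsProbabilityMeasure (P.map X) := Measure.isProbabilityMeasure_map hX.aemeasurable
  have hIoo : ∀ w ∈ Set.Ioo (0 : ℝ) 1, P.real {ω | cdf (P.map X) (X ω) ≤ w} = w := by
    intro w hw
    obtain ⟨x, hx, hx'⟩ := exists_quantile hF (monotone_cdf _) (tendsto_cdf_atBot _)
      (tendsto_cdf_atTop _) hw
    simp_rw [hx']
    rw [← hx, cdf_eq_real, map_measureReal_apply hX measurableSet_Iic]
    rfl
  -- The level `0` may have no quantile, so it is squeezed under small positive levels.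
  rcases hu.1.eq_or_lt with rfl | h0
  · refine le_antisymm (le_of_forall_pos_le_add fun ε hε => ?_) measureReal_nonneg
    have hw : min ε (1 / 2) ∈ Set.Ioo (0 : ℝ) 1 :=
      ⟨lt_min hε (by norm_num), (min_le_right _ _).trans_lt (by norm_num)⟩
    have h1 : P.real {ω | cdf (P.map X) (X ω) ≤ 0} ≤
        P.real {ω | cdf (P.map X) (X ω) ≤ min ε (1 / 2)} :=
      measureReal_mono fun ω (hω : _ ≤ _) => hω.trans hw.1.le
    rw [hIoo _ hw] at h1
    linarith [min_le_left ε (1 / 2)]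
  · rcases hu.2.eq_or_lt with rfl | h1
    · simp [cdf_le_one]
    · exact hIoo u ⟨h0, h1⟩

lemma measureReal_cdf_comp_le_and_le {X Y : Ω → ℝ} (hX : Measurable X) (hY : Measurable Y)
    (hF : Continuous (cdf (P.map X))) (hG : Continuous (cdf (P.map Y)))
    {C : ℝ → ℝ → ℝ} (hC : IsCopula C)
    (hSklar : ∀ x y : ℝ, P.real {ω | X ω ≤ x ∧ Y ω ≤ y} = C (cdf (P.map X) x) (cdf (P.map Y) y))
    {u v : ℝ} (hu : u ∈ Set.Icc (0 : ℝ) 1) (hv : v ∈ Set.Icc (0 : ℝ) 1) :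
    P.real {ω | cdf (P.map X) (X ω) ≤ u ∧ cdf (P.map Y) (Y ω) ≤ v} = C u v := by
  have hmX := measureReal_cdf_comp_le hX hF hu
  have hmY := measureReal_cdf_comp_le hY hG hv
  rcases hu.1.eq_or_lt with rfl | hu0
  · rw [hC.zero_left v hv]
    exact le_antisymm ((measureReal_mono fun ω hω => hω.1).trans_eq hmX) measureReal_nonneg
  rcases hv.1.eq_or_lt with rfl | hv0
  · rw [hC.zero_right u hu]
    exact le_antisymm ((measureReal_mono fun ω hω => hω.2).trans_eq hmY) measureReal_nonneg
  rcases hu.2.eq_or_lt with rfl | hu1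
  · rw [hC.one_left v hv]
    simpa [cdf_le_one] using hmY
  rcases hv.2.eq_or_lt with rfl | hv1
  · rw [hC.one_right u hu]
    simpa [cdf_le_one] using hmX
  obtain ⟨x, hx, hx'⟩ := exists_quantile hF (monotone_cdf _) (tendsto_cdf_atBot _)
    (tendsto_cdf_atTop _) ⟨hu0, hu1⟩
  obtain ⟨y, hy, hy'⟩ := exists_quantile hG (monotone_cdf _) (tendsto_cdf_atBot _)
    (tendsto_cdf_atTop _) ⟨hv0, hv1⟩
  simp_rw [hx', hy']
  rw [hSklar, hx, hy]

/-- The mass of a point is the jump of the distribution function there. -/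
lemma nullSingletonClass_of_continuous_cdf {μ : Measure ℝ} [IsProbabilityMeasure μ]
    (hF : Continuous (cdf μ)) : NullSingletonClass μ := by
  refine ⟨fun a => ?_⟩
  rw [← measure_cdf μ, StieltjesFunction.measure_singleton,
    hF.continuousAt.continuousWithinAt.leftLim_eq, sub_self, ENNReal.ofReal_zero]

/-- By Fubini: under the product law every section of the diagonal is a single point, hence null. -/
lemma ae_ne_of_indepFun {X Y : Ω → ℝ} (hX : Measurable X) (hY : Measurable Y)
    (hXY : IndepFun X Y P) [NullSingletonClass (P.map Y)] : ∀ᵐ ω ∂P, X ω ≠ Y ω := by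
  have : IsProbabilityMeasure (P.map Y) := Measure.isProbabilityMeasure_map hY.aemeasurable
  have hD : MeasurableSet {w : ℝ × ℝ | w.1 = w.2} :=
    measurableSet_eq_fun measurable_fst measurable_snd
  have h := (indepFun_iff_map_prod_eq_prod_map_map hX.aemeasurable hY.aemeasurable).1 hXY
  have h0 : P.map (fun ω => (X ω, Y ω)) {w : ℝ × ℝ | w.1 = w.2} = 0 := by
    rw [h, Measure.measure_prod_null hD]
    refine ae_of_all _ fun a => ?_
    have : Prod.mk a ⁻¹' {w : ℝ × ℝ | w.1 = w.2} = {a} := by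
      ext b
      simp [eq_comm]
    simp [this]
  rw [Measure.map_apply (hX.prodMk hY) hD] at h0
  rw [ae_iff]
  simpa using h0

lemma ae_injective_of_iIndepFun {X : ℕ → Ω → ℝ} (hX : ∀ i, Measurable (X i))
    (hindep : iIndepFun X P) (hident : ∀ i, IdentDistrib (X i) (X 0) P P)
    (hF : Continuous (cdf (P.map (X 0)))) :
    ∀ᵐ ω ∂P, Function.Injective (fun i => X i ω) := by
  have hpair : ∀ i j : ℕ, ∀ᵐ ω ∂P, i ≠ j → X i ω ≠ X j ω := by
    intro i j
    by_cases hij : i = j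
    · simp [hij]
    · have : IsProbabilityMeasure (P.map (X 0)) :=
        Measure.isProbabilityMeasure_map (hX 0).aemeasurable
      have : NullSingletonClass (P.map (X j)) := by
        rw [(hident j).map_eq]
        exact nullSingletonClass_of_continuous_cdf hF
      filter_upwards [ae_ne_of_indepFun (hX i) (hX j) (hindep.indepFun hij)] with ω hω _ using hω
  filter_upwards [ae_all_iff.2 fun i => ae_all_iff.2 (hpair i)] with ω hω i j hij
  by_contra hne
  exact hω i j hne hij

end Marginals

/-! ### Elementary properties of copulas -/

namespace IsCopula

variable {C : ℝ → ℝ → ℝ}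

/-- The rectangles `[u, u'] × [0, v]` and `[u, u'] × [v, 1]` both have nonnegative mass. -/
lemma sub_mem_Icc_left (hC : IsCopula C) {u u' v : ℝ} (hu : u ∈ Set.Icc (0 : ℝ) 1)
    (hu' : u' ∈ Set.Icc (0 : ℝ) 1) (hv : v ∈ Set.Icc (0 : ℝ) 1) (h : u ≤ u') :
    C u' v - C u v ∈ Set.Icc 0 (u' - u) := by
  have h1 := hC.two_increasing u u' 0 v hu.1 h hu'.2 le_rfl hv.1 hv.2
  have h2 := hC.two_increasing u u' v 1 hu.1 h hu'.2 hv.1 hv.2 le_rfl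
  rw [hC.zero_right u hu, hC.zero_right u' hu'] at h1
  rw [hC.one_right u hu, hC.one_right u' hu'] at h2
  constructor <;> linarith

lemma swap (hC : IsCopula C) : IsCopula (fun u v => C v u) where
  zero_left := hC.zero_right
  zero_right := hC.zero_left
  one_left := hC.one_right
  one_right := hC.one_left
  two_increasing u₁ u₂ v₁ v₂ h1 h2 h3 h4 h5 h6 := by
    linarith [hC.two_increasing v₁ v₂ u₁ u₂ h4 h5 h6 h1 h2 h3]

lemma abs_sub_le_left (hC : IsCopula C) {u u' v : ℝ} (hu : u ∈ Set.Icc (0 : ℝ) 1)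
    (hu' : u' ∈ Set.Icc (0 : ℝ) 1) (hv : v ∈ Set.Icc (0 : ℝ) 1) :
    |C u v - C u' v| ≤ |u - u'| := by
  rcases le_total u u' with h | h
  · have := hC.sub_mem_Icc_left hu hu' hv h
    rw [abs_sub_comm, abs_sub_comm u, abs_of_nonneg this.1, abs_of_nonneg (by linarith)]
    exact this.2
  · have := hC.sub_mem_Icc_left hu' hu hv h
    rw [abs_of_nonneg this.1, abs_of_nonneg (by linarith)]
    exact this.2

lemma abs_sub_le (hC : IsCopula C) {u u' v v' : ℝ} (hu : u ∈ Set.Icc (0 : ℝ) 1)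
    (hu' : u' ∈ Set.Icc (0 : ℝ) 1) (hv : v ∈ Set.Icc (0 : ℝ) 1) (hv' : v' ∈ Set.Icc (0 : ℝ) 1) :
    |C u v - C u' v'| ≤ |u - u'| + |v - v'| :=
  (_root_.abs_sub_le _ (C u' v) _).trans
    (add_le_add (hC.abs_sub_le_left hu hu' hv) (hC.swap.abs_sub_le_left hv hv' hu'))

/-- It combines `C u v ≤ min u v` with `1 - C u v ≤ (1 - u) + (1 - v)`. One variance bound then
serves both tails and infinite coordinates. -/
lemma mul_one_sub_le (hC : IsCopula C) {u v : ℝ} (hu : u ∈ Set.Icc (0 : ℝ) 1)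
    (hv : v ∈ Set.Icc (0 : ℝ) 1) :
    C u v * (1 - C u v) ≤ u * (1 - u) + v * (1 - v) := by
  have z : (0 : ℝ) ∈ Set.Icc (0 : ℝ) 1 := ⟨le_rfl, zero_le_one⟩
  have o : (1 : ℝ) ∈ Set.Icc (0 : ℝ) 1 := ⟨zero_le_one, le_rfl⟩
  have h1 := hC.sub_mem_Icc_left z hu hv hu.1
  have h2 := hC.swap.sub_mem_Icc_left z hv hu hv.1
  have h3 := hC.sub_mem_Icc_left hu o hv hu.2
  simp only [hC.zero_left v hv, hC.zero_right u hu, hC.one_left v hv, sub_zero] at h1 h2 h3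
  calc C u v * (1 - C u v) ≤ C u v * ((1 - u) + (1 - v)) := by
        gcongr
        · exact h1.1
        · linarith [h3.2]
    _ = C u v * (1 - u) + C u v * (1 - v) := by ring
    _ ≤ u * (1 - u) + v * (1 - v) := by
        gcongr
        · linarith [hu.2]
        · exact h1.2
        · linarith [hv.2]
        · exact h2.2

end IsCopula

/-! ### Almost sure convergence at a point -/

section Pointwise

variable {Ω : Type*} [MeasurableSpace Ω] {P : Measure Ω} [IsProbabilityMeasure P]

lemma ae_tendsto_empiricalCopula_sub_div {X Y : ℕ → Ω → ℝ} (hX : ∀ i, Measurable (X i))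
    (hY : ∀ i, Measurable (Y i)) (hindep : iIndepFun (fun i ω => (X i ω, Y i ω)) P)
    (hident : ∀ i, IdentDistrib (fun ω => (X i ω, Y i ω)) (fun ω => (X 0 ω, Y 0 ω)) P P)
    (hF : Continuous (cdf (P.map (X 0)))) (hG : Continuous (cdf (P.map (Y 0))))
    {C : ℝ → ℝ → ℝ} (hC : IsCopula C)
    (hSklar : ∀ x y : ℝ, P.real {ω | X 0 ω ≤ x ∧ Y 0 ω ≤ y}
      = C (cdf (P.map (X 0)) x) (cdf (P.map (Y 0)) y))
    {k : ℕ → ℝ} (hk : ∀ n, 1 ≤ n → 0 < k n) (hk_top : Tendsto k atTop atTop)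
    (hklog : (fun n : ℕ => Real.log n) =o[atTop] k)
    (hinj : ∀ᵐ ω ∂P, Function.Injective (fun i => X i ω) ∧ Function.Injective (fun i => Y i ω))
    {u v : ℕ → ℝ} (hu : ∀ n, u n ∈ Set.Icc (0 : ℝ) 1) (hv : ∀ n, v n ∈ Set.Icc (0 : ℝ) 1) {B : ℝ}
    (huB : ∀ n, 1 ≤ n → u n * (1 - u n) ≤ B * (k n / n))
    (hvB : ∀ n, 1 ≤ n → v n * (1 - v n) ≤ B * (k n / n)) :
    ∀ᵐ ω ∂P, Tendsto (fun n : ℕ =>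
      (empiricalCopula n (fun i => X i ω) (fun i => Y i ω) (u n) (v n) - C (u n) (v n)) / (k n / n))
      atTop (𝓝 0) := by
  set F := cdf (P.map (X 0))
  set G := cdf (P.map (Y 0))
  -- Used three times: for the joint event and, with one level set to `1`, for each of the two
  -- margins.
  have hcdf : ∀ u v : ℕ → ℝ, (∀ n, u n ∈ Set.Icc (0 : ℝ) 1) → (∀ n, v n ∈ Set.Icc (0 : ℝ) 1) →
      (∀ n, 1 ≤ n → u n * (1 - u n) + v n * (1 - v n) ≤ (2 * B) * (k n / n)) →
      ∀ᵐ ω ∂P, Tendsto (fun n : ℕ =>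
        (empiricalCDF n F G (fun i => X i ω) (fun i => Y i ω) (u n) (v n) - C (u n) (v n))
          / (k n / n)) atTop (𝓝 0) := by
    intro u v hu hv hB
    have := ae_tendsto_frequency_sub_div (fun i => (hX i).prodMk (hY i)) hindep hident hk hklog
      (A := fun n => {w : ℝ × ℝ | F w.1 ≤ u n ∧ G w.2 ≤ v n}) (p := fun n => C (u n) (v n))
      (fun n => ((isClosed_le (hF.comp continuous_fst) continuous_const).inter
        (isClosed_le (hG.comp continuous_snd) continuous_const)).measurableSet)
      (fun n => measureReal_cdf_comp_le_and_le (hX 0) (hY 0) hF hG hC hSklar (hu n) (hv n))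
      (fun n hn => (hC.mul_one_sub_le (hu n) (hv n)).trans (hB n hn))
    filter_upwards [this] with ω hω
    refine hω.congr fun n => ?_
    simp only [frequency, empiricalCDF, Set.mem_ofPred_eq]
  have one_mem : (1 : ℝ) ∈ Set.Icc (0 : ℝ) 1 := ⟨zero_le_one, le_rfl⟩
  have hB0 : ∀ w : ℝ, w ∈ Set.Icc (0 : ℝ) 1 → 0 ≤ w * (1 - w) := fun w hw =>
    mul_nonneg hw.1 (sub_nonneg.2 hw.2)
  have h1 := hcdf u v hu hv fun n hn => by linarith [huB n hn, hvB n hn]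
  have h2 := hcdf u (fun _ => 1) hu (fun _ => one_mem) fun n hn => by
    linarith [huB n hn, hB0 _ (hu n)]
  have h3 := hcdf (fun _ => 1) v (fun _ => one_mem) hv fun n hn => by
    linarith [hvB n hn, hB0 _ (hv n)]
  filter_upwards [h1, h2, h3, hinj] with ω t1 t2 t3 hi
  have hlim := ((t1.abs.add t2.abs).add t3.abs).add
    ((tendsto_const_nhds (x := (2 : ℝ))).div_atTop hk_top)
  simp only [abs_zero, add_zero] at hlim
  refine squeeze_zero_norm' ?_ hlim
  filter_upwards [eventually_ge_atTop 1] with n hn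
  have hn' : (0 : ℝ) < n := by exact_mod_cast hn
  have ht : 0 < k n / n := div_pos (hk n hn) hn'
  have hmain := abs_empiricalCopula_sub_empiricalCDF_le hn (monotone_cdf (P.map (X 0)))
    (monotone_cdf (P.map (Y 0))) (cdf_le_one _) (cdf_le_one _) (hi.1.injOn (s := Finset.range n))
    (hi.2.injOn (s := Finset.range n)) (hu n) (hv n)
  have habs : ∀ z : ℝ, |z / (k n / n)| = |z| / (k n / n) := fun z => by
    rw [abs_div, abs_of_pos ht]
  rw [Real.norm_eq_abs, habs, habs, habs, habs, hC.one_left _ (hv n), hC.one_right _ (hu n)]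
  have e : 2 / k n = 2 / n / (k n / n) := by
    have := (hk n hn).ne'
    field_simp
  rw [e, ← add_div, ← add_div, ← add_div]
  gcongr
  refine (_root_.abs_sub_le _ (empiricalCDF n F G (fun i => X i ω) (fun i => Y i ω) (u n) (v n))
    _).trans ?_
  linarith

end Pointwise

/-! ### Approximate Lipschitz continuity of rescaled functions -/

lemma scaled_mul_one_sub_le {t : ℝ} (ht : 0 < t) (x : ℝ≥0∞) :
    scaled t x * (1 - scaled t x) ≤ x.toReal * t := by
  -- At `∞` both sides vanish: the scaled value is `1`, and `ENNReal.toReal` sends `⊤` to `0`.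
  by_cases hx : x = ⊤
  · subst hx
    have : scaled t ⊤ = 1 := by
      simp [scaled, ENNReal.mul_top (ENNReal.ofReal_pos.2 ht).ne']
    simp [this]
  · have hs := scaled_mem_Icc t x
    have h1 : scaled t x ≤ x.toReal * t := by
      calc scaled t x ≤ (ENNReal.ofReal t * x).toReal :=
            ENNReal.toReal_mono (ENNReal.mul_ne_top ENNReal.ofReal_ne_top hx) (min_le_left _ _)
        _ = x.toReal * t := by rw [ENNReal.toReal_mul, ENNReal.toReal_ofReal ht.le, mul_comm]
    nlinarith [hs.1, hs.2]

lemma scaled_le_scaled_add {t η : ℝ} (ht : 0 ≤ t) (hη : 0 ≤ η) {x y : ℝ≥0∞}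
    (h : x ≤ y + ENNReal.ofReal η) : scaled t x ≤ scaled t y + t * η := by
  have h1 : min (ENNReal.ofReal t * x) 1 ≤
      min (ENNReal.ofReal t * y) 1 + ENNReal.ofReal (t * η) := by
    rw [← min_add_add_right, ENNReal.ofReal_mul ht, ← mul_add]
    exact min_le_min (mul_le_mul_right h _) le_self_add
  have hne : min (ENNReal.ofReal t * y) 1 ≠ ⊤ := ne_top_of_le_ne_top ENNReal.one_ne_top
    (min_le_right _ _)
  have h2 := ENNReal.toReal_mono (ENNReal.add_ne_top.2 ⟨hne, ENNReal.ofReal_ne_top⟩) h1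
  rwa [ENNReal.toReal_add hne ENNReal.ofReal_ne_top,
    ENNReal.toReal_ofReal (mul_nonneg ht hη)] at h2

/-- The coordinates of `p` and `q` differ by at most `η`, infinite coordinates being close only to
infinite ones. -/
def Near (η : ℝ) (p q : ExtQuadrant) : Prop :=
  (p.1.1 ≤ q.1.1 + ENNReal.ofReal η ∧ q.1.1 ≤ p.1.1 + ENNReal.ofReal η) ∧
  (p.1.2 ≤ q.1.2 + ENNReal.ofReal η ∧ q.1.2 ≤ p.1.2 + ENNReal.ofReal η)

lemma abs_scaled_sub_le {t η : ℝ} (ht : 0 ≤ t) (hη : 0 ≤ η) {x y : ℝ≥0∞}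
    (h : x ≤ y + ENNReal.ofReal η ∧ y ≤ x + ENNReal.ofReal η) :
    |scaled t x - scaled t y| ≤ t * η := by
  rw [abs_sub_le_iff]
  exact ⟨by linarith [scaled_le_scaled_add ht hη h.1], by linarith [scaled_le_scaled_add ht hη h.2]⟩

/-- `f` is Lipschitz up to an additive error `δ`. -/
def QuasiLipschitz (δ : ℝ) (f : ExtQuadrant → ℝ) : Prop :=
  ∀ η : ℝ, 0 ≤ η → ∀ p q, Near η p q → |f p - f q| ≤ 4 * η + δ

lemma quasiLipschitz_lowerRescaled {D : ℝ → ℝ → ℝ} {δ t : ℝ} (ht : 0 < t)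
    (hD : ∀ u ∈ Set.Icc (0 : ℝ) 1, ∀ u' ∈ Set.Icc (0 : ℝ) 1, ∀ v ∈ Set.Icc (0 : ℝ) 1,
      ∀ v' ∈ Set.Icc (0 : ℝ) 1, |D u v - D u' v'| ≤ |u - u'| + |v - v'| + δ) :
    QuasiLipschitz (δ / t) (lowerRescaled D t) := by
  intro η hη p q hpq
  have h1 := abs_scaled_sub_le ht.le hη hpq.1
  have h2 := abs_scaled_sub_le ht.le hη hpq.2
  have h3 := hD _ (scaled_mem_Icc t p.1.1) _ (scaled_mem_Icc t q.1.1) _ (scaled_mem_Icc t p.1.2) _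
    (scaled_mem_Icc t q.1.2)
  have e : (4 * η + δ / t) * t = 4 * (t * η) + δ := by field_simp
  have h0 : 0 ≤ t * η := by positivity
  rw [lowerRescaled, lowerRescaled, ← sub_div, abs_div, abs_of_pos ht, div_le_iff₀ ht, e]
  linarith

/-- The linear terms contribute `2 η` and `D` another `2 η`, whence the constant `4` in
`QuasiLipschitz`. -/
lemma quasiLipschitz_upperRescaled {D : ℝ → ℝ → ℝ} {δ t : ℝ} (ht : 0 < t)
    (hD : ∀ u ∈ Set.Icc (0 : ℝ) 1, ∀ u' ∈ Set.Icc (0 : ℝ) 1, ∀ v ∈ Set.Icc (0 : ℝ) 1,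
      ∀ v' ∈ Set.Icc (0 : ℝ) 1, |D u v - D u' v'| ≤ |u - u'| + |v - v'| + δ) :
    QuasiLipschitz (δ / t) (upperRescaled D t) := by
  intro η hη p q hpq
  have h1 := abs_scaled_sub_le ht.le hη hpq.1
  have h2 := abs_scaled_sub_le ht.le hη hpq.2
  have h3 := hD _ (one_sub_mem_Icc (scaled_mem_Icc t p.1.1)) _
    (one_sub_mem_Icc (scaled_mem_Icc t q.1.1)) _ (one_sub_mem_Icc (scaled_mem_Icc t p.1.2)) _
    (one_sub_mem_Icc (scaled_mem_Icc t q.1.2))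
  have e : (4 * η + δ / t) * t = 4 * (t * η) + δ := by field_simp
  have e1 : ∀ a b : ℝ, |1 - a - (1 - b)| = |a - b| := fun a b => by
    rw [abs_sub_comm a b]; congr 1; ring
  rw [e1, e1] at h3
  rw [upperRescaled, upperRescaled, ← sub_div, abs_div, abs_of_pos ht, div_le_iff₀ ht, e]
  rw [abs_le] at h1 h2 ⊢
  have h4 := abs_le.1 (h3.trans (add_le_add_left (add_le_add (abs_le.2 h1) (abs_le.2 h2)) δ))
  constructor <;> linarith [h1.1, h1.2, h2.1, h2.2, h4.1, h4.2]

lemma QuasiLipschitz.of_tendsto {f : ℝ → ExtQuadrant → ℝ} {Λ : ExtQuadrant → ℝ}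
    (hf : ∀ t, 0 < t → QuasiLipschitz 0 (f t))
    (h : ∀ p, Tendsto (fun t => f t p) (𝓝[>] 0) (𝓝 (Λ p))) : QuasiLipschitz 0 Λ := by
  intro η hη p q hpq
  refine le_of_tendsto ((h p).sub (h q)).abs ?_
  filter_upwards [self_mem_nhdsWithin] with t ht using hf t ht η hη p q hpq

/-! ### Uniform convergence on the exhausting sets -/

lemma T_subset (i : ℕ) :
    T i ⊆ {p | (p.1.1 = ⊤ ∨ p.1.1 ≤ i) ∧ (p.1.2 = ⊤ ∨ p.1.2 ≤ i)} := by
  induction i with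
  | zero => simp [T]
  | succ j ih =>
    have hcast : ((j : ℕ) : ℝ≥0∞) ≤ ((j + 1 : ℕ) : ℝ≥0∞) := by exact_mod_cast Nat.le_succ j
    have hcast' : ((j / 3 + 1 : ℕ) : ℝ≥0∞) ≤ ((j + 1 : ℕ) : ℝ≥0∞) := by
      have : j / 3 + 1 ≤ j + 1 := by omega
      exact_mod_cast this
    rintro p (hp | hp)
    · exact ⟨(ih hp).1.imp id fun h => h.trans hcast, (ih hp).2.imp id fun h => h.trans hcast⟩
    · unfold piece at hp
      split_ifs at hp
      · exact ⟨Or.inl hp.1, Or.inr (hp.2.trans hcast')⟩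
      · exact ⟨Or.inr (hp.1.trans hcast'), Or.inl hp.2⟩
      · exact ⟨Or.inr (hp.1.trans hcast'), Or.inr (hp.2.trans hcast')⟩

/-- The net consists of `∞` and the multiples of `η` up to `M`, with rounding downwards. The last
clause prevents a pair of net coordinates from becoming the excluded point `(∞, ∞)`. -/
lemma exists_finite_coordinate_net (M : ℕ) {η : ℝ} (hη : 0 < η) :
    ∃ R : Set ℝ≥0∞, R.Finite ∧ ∀ x : ℝ≥0∞, (x = ⊤ ∨ x ≤ M) →
      ∃ r ∈ R, (x ≤ r + ENNReal.ofReal η ∧ r ≤ x + ENNReal.ofReal η) ∧ (r = ⊤ → x = ⊤) := by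
  refine ⟨insert ⊤ ((fun j : ℕ => ENNReal.ofReal (j * η)) '' Set.Iic ⌊M / η⌋₊),
    ((Set.finite_Iic _).image _).insert _, ?_⟩
  rintro x (rfl | hx)
  · exact ⟨⊤, Set.mem_insert _ _, by simp⟩
  · have hx' : x ≠ ⊤ := ne_top_of_le_ne_top (ENNReal.natCast_ne_top M) hx
    lift x to NNReal using hx'
    have hxM : (x : ℝ) ≤ M := by exact_mod_cast hx
    have h1 : (⌊(x : ℝ) / η⌋₊ : ℝ) * η ≤ x := by
      rw [← le_div_iff₀ hη]
      exact Nat.floor_le (by positivity)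
    have h2 : (x : ℝ) ≤ ⌊(x : ℝ) / η⌋₊ * η + η := by
      have := (div_le_iff₀ hη).1 (Nat.lt_floor_add_one ((x : ℝ) / η)).le
      linarith
    have hx0 : (x : ℝ≥0∞) = ENNReal.ofReal (x : ℝ) := (ENNReal.ofReal_coe_nnreal).symm
    refine ⟨ENNReal.ofReal (⌊(x : ℝ) / η⌋₊ * η),
      Set.mem_insert_of_mem _ ⟨_, ?_, rfl⟩, ⟨?_, ?_⟩, fun h => absurd h ENNReal.ofReal_ne_top⟩
    · exact Nat.floor_le_floor (by gcongr)
    · rw [← ENNReal.ofReal_add (by positivity) hη.le, hx0]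
      exact ENNReal.ofReal_le_ofReal h2
    · rw [hx0]
      exact (ENNReal.ofReal_le_ofReal h1).trans le_self_add

lemma exists_finite_net (i : ℕ) {η : ℝ} (hη : 0 < η) :
    ∃ S : Set ExtQuadrant, S.Finite ∧ ∀ p ∈ T i, ∃ q ∈ S, Near η p q := by
  obtain ⟨R, hR, hnet⟩ := exists_finite_coordinate_net i hη
  refine ⟨Subtype.val ⁻¹' (R ×ˢ R), (hR.prod hR).preimage Subtype.val_injective.injOn, ?_⟩
  intro p hp
  obtain ⟨h1, h2⟩ := T_subset i hp
  obtain ⟨r, hr, hr1, hr2⟩ := hnet _ h1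
  obtain ⟨s, hs, hs1, hs2⟩ := hnet _ h2
  refine ⟨⟨(r, s), fun h => p.2 ?_⟩, ⟨hr, hs⟩, hr1, hs1⟩
  rw [Prod.mk.injEq] at h
  exact Prod.ext (hr2 h.1) (hs2 h.2)

/-- `Q` is the union of finite nets of all `T i` at all scales `1 / (j + 1)`. It is fixed before the
functions, so one null set will serve for all of its points. -/
lemma exists_countable_tendstoUniformlyOn :
    ∃ Q : Set ExtQuadrant, Q.Countable ∧
      ∀ (f : ℕ → ExtQuadrant → ℝ) (Λ : ExtQuadrant → ℝ) (e : ℕ → ℝ), Tendsto e atTop (𝓝 0) →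
        (∀ n, 1 ≤ n → QuasiLipschitz (e n) (f n)) → QuasiLipschitz 0 Λ →
        (∀ q ∈ Q, Tendsto (fun n => f n q) atTop (𝓝 (Λ q))) →
        ∀ i, TendstoUniformlyOn f Λ atTop (T i) := by
  choose S hfin hS using fun i j : ℕ =>
    exists_finite_net i (η := 1 / ((j : ℝ) + 1)) (by positivity)
  refine ⟨⋃ i, ⋃ j, S i j, Set.countable_iUnion fun i => Set.countable_iUnion fun j =>
    (hfin i j).countable, fun f Λ e he hf hΛ hQ i => ?_⟩
  rw [Metric.tendstoUniformlyOn_iff]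
  intro ε hε
  -- Four quarters of `ε`: `4 η` for each of `f n` and `Λ`, the error `e n`, and the deviation at
  -- the net point.
  obtain ⟨j, hj⟩ := exists_nat_one_div_lt (show 0 < ε / 16 by positivity)
  set η : ℝ := 1 / ((j : ℝ) + 1)
  have hη : 0 ≤ η := by positivity
  have hnet : ∀ᶠ n in atTop, ∀ q ∈ S i j, |f n q - Λ q| < ε / 4 := by
    rw [(hfin i j).eventually_all]
    intro q hq
    have := hQ q (Set.mem_iUnion₂.2 ⟨i, j, hq⟩)
    exact (Metric.tendsto_nhds.1 this) (ε / 4) (by positivity)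
  have he' : ∀ᶠ n in atTop, e n < ε / 4 := he.eventually (gt_mem_nhds (by positivity))
  filter_upwards [hnet, he', eventually_ge_atTop 1] with n h1 h2 hn p hp
  obtain ⟨q, hq, hpq⟩ := hS i j p hp
  have h3 := hf n hn η hη p q hpq
  have h4 := hΛ η hη p q hpq
  have h5 := h1 q hq
  rw [Real.dist_eq]
  rw [abs_le] at h3 h4
  rw [abs_lt] at h5 ⊢
  constructor <;> linarith [h3.1, h3.2, h4.1, h4.2, h5.1, h5.2]

lemma tendsto_bDist {f : ℕ → ExtQuadrant → ℝ} {Λ : ExtQuadrant → ℝ}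
    (h : ∀ i, TendstoUniformlyOn f Λ atTop (T i)) :
    Tendsto (fun n => bDist (f n) Λ) atTop (𝓝 0) := by
  have hterm : ∀ i : ℕ, Tendsto (fun n => (2 : ℝ≥0∞)⁻¹ ^ (i + 1) *
      min (⨆ p ∈ T (i + 1), ENNReal.ofReal |f n p - Λ p|) 1) atTop (𝓝 0) := by
    intro i
    have hsup : Tendsto (fun n => ⨆ p ∈ T (i + 1), ENNReal.ofReal |f n p - Λ p|) atTop (𝓝 0) := by
      rw [ENNReal.tendsto_nhds_zero]
      intro ε hε
      obtain ⟨r, hr0, hr⟩ := ENNReal.lt_iff_exists_nnreal_btwn.1 hε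
      filter_upwards [Metric.tendstoUniformlyOn_iff.1 (h (i + 1)) r (by exact_mod_cast hr0)]
        with n hn
      refine iSup₂_le fun p hp => le_trans ?_ hr.le
      have := hn p hp
      rw [Real.dist_eq, abs_sub_comm] at this
      exact ENNReal.ofReal_le_of_le_toReal (by simpa using this.le)
    have hmin : Tendsto (fun n => min (⨆ p ∈ T (i + 1), ENNReal.ofReal |f n p - Λ p|) 1) atTop
        (𝓝 0) := tendsto_of_tendsto_of_tendsto_of_le_of_le tendsto_const_nhds hsup
      (fun _ => zero_le) (fun _ => min_le_left _ _)
    have := ENNReal.Tendsto.const_mul (a := (2 : ℝ≥0∞)⁻¹ ^ (i + 1)) hmin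
      (Or.inr (ENNReal.pow_ne_top (by simp)))
    simpa using this
  -- The series is an integral against counting measure, dominated by the summable `2 ^ -(i + 1)`.
  have hlint := tendsto_lintegral_of_dominated_convergence (μ := Measure.count)
    (F := fun n (i : ℕ) => (2 : ℝ≥0∞)⁻¹ ^ (i + 1) *
      min (⨆ p ∈ T (i + 1), ENNReal.ofReal |f n p - Λ p|) 1) (f := fun _ => 0)
    (fun i : ℕ => (2 : ℝ≥0∞)⁻¹ ^ (i + 1)) (fun n => measurable_from_top)
    (fun n => ae_of_all _ fun i => mul_le_of_le_one_right' (min_le_right _ _))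
    (by
      rw [lintegral_count]
      simp_rw [pow_succ]
      rw [ENNReal.tsum_mul_right, ENNReal.tsum_geometric]
      exact ENNReal.mul_ne_top (by simp) (by simp))
    (ae_of_all _ hterm)
  simpa only [lintegral_count, tsum_zero, bDist] using hlint

lemma convergesInBInfty_of_tendstoUniformlyOn {f : ℕ → ExtQuadrant → ℝ} {Λ : ExtQuadrant → ℝ}
    (hf : ∀ n, ∃ M : ℝ, ∀ p, |f n p| ≤ M) (h : ∀ i, TendstoUniformlyOn f Λ atTop (T i)) :
    ConvergesInBInfty f Λ := by
  refine ⟨fun n i => (hf n).imp fun M hM p _ => hM p, fun i => ?_, tendsto_bDist h⟩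
  -- The limit inherits boundedness from a single `f n` within distance `1` of it.
  obtain ⟨n, hn⟩ := (Metric.tendstoUniformlyOn_iff.1 (h i) 1 one_pos).exists
  obtain ⟨M, hM⟩ := hf n
  refine ⟨M + 1, fun p hp => ?_⟩
  have h1 := hn p hp
  have h2 := hM p
  rw [Real.dist_eq] at h1
  rw [abs_lt] at h1
  rw [abs_le] at h2 ⊢
  constructor <;> linarith [h1.1, h1.2, h2.1, h2.2]

lemma exists_bound_checkerboardTail {n m : ℕ} (hm : 1 ≤ n → 1 ≤ m) (k : ℝ) (x y : ℕ → ℝ) :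
    (∃ M : ℝ, ∀ p, |checkerboardLower n k m x y p| ≤ M) ∧
    (∃ M : ℝ, ∀ p, |checkerboardUpper n k m x y p| ≤ M) := by
  -- For `n = 0` the scale `k / 0` is `0`, and division by it makes both estimators zero.
  rcases Nat.eq_zero_or_pos n with rfl | hn
  · exact ⟨⟨0, fun p => by simp [checkerboardLower, lowerRescaled]⟩,
      ⟨0, fun p => by simp [checkerboardUpper, upperRescaled]⟩⟩
  have hD : ∀ u v, |empiricalCopula n x y u v| ≤ 1 := fun u v => by
    have := empiricalCopula_mem_Icc n x y u v
    rw [abs_of_nonneg this.1]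
    exact this.2
  refine ⟨⟨1 / |k / n|, fun p => ?_⟩, ⟨2 / |k / n|, fun p => ?_⟩⟩
  · rw [checkerboardLower, lowerRescaled, abs_div]
    gcongr
    exact abs_checkerboard_le (hm hn) hD (scaled_mem_Icc _ _) (scaled_mem_Icc _ _)
  · rw [checkerboardUpper, upperRescaled, abs_div]
    gcongr
    have h1 := abs_le.1 (abs_checkerboard_le (hm hn) hD
      (one_sub_mem_Icc (scaled_mem_Icc (k / n) p.1.1))
      (one_sub_mem_Icc (scaled_mem_Icc (k / n) p.1.2)))
    have h2 := scaled_mem_Icc (k / n) p.1.1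
    have h3 := scaled_mem_Icc (k / n) p.1.2
    rw [abs_le]
    constructor <;> linarith [h1.1, h1.2, h2.1, h2.2, h3.1, h3.2]

/-! ### Strong consistency -/

lemma isLittleO_log_of_isLittleO_log_sq {k : ℕ → ℝ}
    (h : (fun n : ℕ => Real.log n ^ 2) =o[atTop] k) : (fun n : ℕ => Real.log n) =o[atTop] k := by
  refine IsBigO.trans_isLittleO (IsBigO.of_bound 1 ?_) h
  have hlog : ∀ᶠ n : ℕ in atTop, 1 ≤ Real.log n :=
    (Real.tendsto_log_atTop.comp tendsto_natCast_atTop_atTop).eventually_ge_atTop 1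
  filter_upwards [hlog] with n hn
  rw [Real.norm_of_nonneg (by linarith), Real.norm_of_nonneg (by positivity)]
  nlinarith

/-- The first term factors as `((n / √k) / m) * (2 / √k)`, a product of two null sequences. -/
lemma tendsto_checkerboard_error {k : ℕ → ℝ} {m : ℕ → ℕ} (hk_top : Tendsto k atTop atTop)
    (hkm : (fun n : ℕ => (n : ℝ) / √(k n)) =o[atTop] (fun n => (m n : ℝ))) :
    Tendsto (fun n : ℕ => 2 * n / (k n * m n) + 2 / k n) atTop (𝓝 0) := by
  have h1 : Tendsto (fun n : ℕ => (2 : ℝ) / k n) atTop (𝓝 0) :=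
    tendsto_const_nhds.div_atTop hk_top
  have h2 : Tendsto (fun n : ℕ => (2 : ℝ) / √(k n)) atTop (𝓝 0) :=
    tendsto_const_nhds.div_atTop (Real.tendsto_sqrt_atTop.comp hk_top)
  have h3 := (hkm.tendsto_div_nhds_zero.mul h2).add h1
  simp only [mul_zero, add_zero] at h3
  refine h3.congr' ?_
  filter_upwards [hk_top.eventually_gt_atTop 0] with n hn
  have hs : √(k n) * √(k n) = k n := Real.mul_self_sqrt hn.le
  congr 1
  rw [div_div, div_mul_div_comm, mul_right_comm, hs, mul_comm (n : ℝ) 2]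

lemma QuasiLipschitz.of_abs_sub_le {f g : ExtQuadrant → ℝ} {δ b : ℝ} (hg : QuasiLipschitz δ g)
    (h : ∀ p, |f p - g p| ≤ b) : QuasiLipschitz (δ + 2 * b) f := by
  intro η hη p q hpq
  have h1 := abs_le.1 (hg η hη p q hpq)
  have h2 := abs_le.1 (h p)
  have h3 := abs_le.1 (h q)
  rw [abs_le]
  constructor <;> linarith [h1.1, h1.2, h2.1, h2.2, h3.1, h3.2]

/-- If `c n → Λ` pointwise and `g n - c n → 0` at countably many well-chosen points, where the `g n`
are Lipschitz up to vanishing errors, then bounded functions `f n` that are uniformly close to `g n`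
converge to `Λ` uniformly on the exhausting sets. -/
lemma exists_countable_convergesInBInfty :
    ∃ Q : Set ExtQuadrant, Q.Countable ∧
      ∀ (f g c : ℕ → ExtQuadrant → ℝ) (Λ : ExtQuadrant → ℝ) (e b : ℕ → ℝ),
        Tendsto e atTop (𝓝 0) → Tendsto b atTop (𝓝 0) →
        (∀ n, 1 ≤ n → QuasiLipschitz (e n) (g n)) → QuasiLipschitz 0 Λ →
        (∀ n, 1 ≤ n → ∀ p, |f n p - g n p| ≤ b n) → (∀ n, ∃ M : ℝ, ∀ p, |f n p| ≤ M) →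
        (∀ p, Tendsto (fun n => c n p) atTop (𝓝 (Λ p))) →
        (∀ q ∈ Q, Tendsto (fun n => g n q - c n q) atTop (𝓝 0)) →
        ConvergesInBInfty f Λ ∧ ∀ i, TendstoUniformlyOn f Λ atTop (T i) := by
  obtain ⟨Q, hQ, huniv⟩ := exists_countable_tendstoUniformlyOn
  refine ⟨Q, hQ, fun f g c Λ e b he hb hg hΛ hfg hf hc hgc => ?_⟩
  have hunif : ∀ i, TendstoUniformlyOn f Λ atTop (T i) := by
    refine huniv f Λ (fun n => e n + 2 * b n) (by simpa using he.add (hb.const_mul 2))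
      (fun n hn => (hg n hn).of_abs_sub_le (hfg n hn)) hΛ fun q hq => ?_
    have h1 : Tendsto (fun n => f n q - g n q) atTop (𝓝 0) := by
      refine squeeze_zero_norm' ?_ hb
      filter_upwards [eventually_ge_atTop 1] with n hn using hfg n hn q
    have h2 := (h1.add (hgc q hq)).add (hc q)
    simpa using h2
  exact ⟨convergesInBInfty_of_tendstoUniformlyOn hf hunif, hunif⟩

end CheckerboardTail

open CheckerboardTail in
theorem theorem4p5 {Ω : Type*} [MeasurableSpace Ω] (P : Measure Ω) [IsProbabilityMeasure P]
    (X Y : ℕ → Ω → ℝ) (hX : ∀ i, Measurable (X i)) (hY : ∀ i, Measurable (Y i))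
    (hindep : iIndepFun (fun i ω => (X i ω, Y i ω)) P)
    (hident : ∀ i, IdentDistrib (fun ω => (X i ω, Y i ω)) (fun ω => (X 0 ω, Y 0 ω)) P P)
    (hF : Continuous (cdf (P.map (X 0)))) (hG : Continuous (cdf (P.map (Y 0))))
    (C : ℝ → ℝ → ℝ) (hC : IsCopula C)
    (hSklar : ∀ x y : ℝ, P.real {ω | X 0 ω ≤ x ∧ Y 0 ω ≤ y}
      = C (cdf (P.map (X 0)) x) (cdf (P.map (Y 0)) y))
    (k : ℕ → ℝ) (m : ℕ → ℕ) (hk : ∀ n, 1 ≤ n → 0 < k n) (hm : ∀ n, 1 ≤ n → 1 ≤ m n)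
    (hk_top : Tendsto k atTop atTop) (hk_n : Tendsto (fun n : ℕ => k n / n) atTop (𝓝 0))
    (hkm : (fun n : ℕ => (n : ℝ) / √(k n)) =o[atTop] (fun n => (m n : ℝ)))
    (hklog : (fun n : ℕ => Real.log n ^ 2) =o[atTop] k) :
    -- strong consistency in the lower tail
    (∀ Λ, IsLowerTailCopula C Λ → ∀ᵐ ω ∂P,
      ConvergesInBInfty
        (fun n => checkerboardLower n (k n) (m n) (fun i => X i ω) (fun i => Y i ω)) Λ ∧
      ∀ i, TendstoUniformlyOn
        (fun n => checkerboardLower n (k n) (m n) (fun i => X i ω) (fun i => Y i ω)) Λ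
        atTop (T i)) ∧
    -- strong consistency in the upper tail
    (∀ Λ, IsUpperTailCopula C Λ → ∀ᵐ ω ∂P,
      ConvergesInBInfty
        (fun n => checkerboardUpper n (k n) (m n) (fun i => X i ω) (fun i => Y i ω)) Λ ∧
      ∀ i, TendstoUniformlyOn
        (fun n => checkerboardUpper n (k n) (m n) (fun i => X i ω) (fun i => Y i ω)) Λ
        atTop (T i)) ∧
    -- bound for the checkerboard error, uniform over the quadrant
    (∀ᵐ ω ∂P, ∀ n, 1 ≤ n → ∀ p : ExtQuadrant,
      (|checkerboardLower n (k n) (m n) (fun i => X i ω) (fun i => Y i ω) p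
          - rawLower n (k n) (fun i => X i ω) (fun i => Y i ω) p|
        ≤ 2 * n / (k n * m n) + 2 / k n) ∧
      (|checkerboardUpper n (k n) (m n) (fun i => X i ω) (fun i => Y i ω) p
          - rawUpper n (k n) (fun i => X i ω) (fun i => Y i ω) p|
        ≤ 2 * n / (k n * m n) + 2 / k n) ∧
      (m n ≤ n →
        |checkerboardLower n (k n) (m n) (fun i => X i ω) (fun i => Y i ω) p
            - rawLower n (k n) (fun i => X i ω) (fun i => Y i ω) p| ≤ 4 * n / (k n * m n) ∧
        |checkerboardUpper n (k n) (m n) (fun i => X i ω) (fun i => Y i ω) p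
            - rawUpper n (k n) (fun i => X i ω) (fun i => Y i ω) p| ≤ 4 * n / (k n * m n))) := by
  have hinj : ∀ᵐ ω ∂P, Function.Injective (fun i => X i ω) ∧
      Function.Injective (fun i => Y i ω) := by
    have h1 := ae_injective_of_iIndepFun hX (hindep.comp (fun _ => Prod.fst) fun _ => measurable_fst)
      (fun i => (hident i).comp measurable_fst) hF
    have h2 := ae_injective_of_iIndepFun hY (hindep.comp (fun _ => Prod.snd) fun _ => measurable_snd)
      (fun i => (hident i).comp measurable_snd) hG
    exact h1.and h2
  have hlog := isLittleO_log_of_isLittleO_log_sq hklog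
  have hb := tendsto_checkerboard_error hk_top hkm
  have ht : ∀ n : ℕ, 1 ≤ n → 0 < k n / n := fun n hn => div_pos (hk n hn) (by exact_mod_cast hn)
  -- The limits defining the tail copulas may thus be taken along `k n / n`.
  have ht0 : Tendsto (fun n : ℕ => k n / n) atTop (𝓝[>] 0) :=
    tendsto_nhdsWithin_iff.2 ⟨hk_n, (eventually_ge_atTop 1).mono ht⟩
  have he : Tendsto (fun n : ℕ => (2 : ℝ) / n / (k n / n)) atTop (𝓝 0) := by
    refine ((tendsto_const_nhds (x := (2 : ℝ))).div_atTop hk_top).congr' ?_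
    filter_upwards [eventually_ge_atTop 1] with n hn
    have : (0 : ℝ) < n := by exact_mod_cast hn
    field_simp
  have hCδ : ∀ u ∈ Set.Icc (0 : ℝ) 1, ∀ u' ∈ Set.Icc (0 : ℝ) 1, ∀ v ∈ Set.Icc (0 : ℝ) 1,
      ∀ v' ∈ Set.Icc (0 : ℝ) 1, |C u v - C u' v'| ≤ |u - u'| + |v - v'| + 0 :=
    fun u hu u' hu' v hv v' hv' => by simpa using hC.abs_sub_le hu hu' hv hv'
  have hscaled : ∀ (p : ExtQuadrant) (n : ℕ), 1 ≤ n →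
      scaled (k n / n) p.1.1 * (1 - scaled (k n / n) p.1.1) ≤
        (p.1.1.toReal + p.1.2.toReal) * (k n / n) ∧
      scaled (k n / n) p.1.2 * (1 - scaled (k n / n) p.1.2) ≤
        (p.1.1.toReal + p.1.2.toReal) * (k n / n) := by
    intro p n hn
    have := ht n hn
    exact ⟨(scaled_mul_one_sub_le this _).trans (by gcongr; simp),
      (scaled_mul_one_sub_le this _).trans (by gcongr; simp)⟩
  obtain ⟨Q, hQ, hconv⟩ := exists_countable_convergesInBInfty
  refine ⟨fun Λ hΛ => ?_, fun Λ hΛ => ?_, ?_⟩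
  · have hpt : ∀ᵐ ω ∂P, ∀ q ∈ Q, Tendsto (fun n =>
        rawLower n (k n) (fun i => X i ω) (fun i => Y i ω) q - lowerRescaled C (k n / n) q)
        atTop (𝓝 0) := by
      refine (ae_ball_iff hQ).2 fun q _ => ?_
      filter_upwards [ae_tendsto_empiricalCopula_sub_div hX hY hindep hident hF hG hC hSklar hk
        hk_top hlog hinj (u := fun n => scaled (k n / n) q.1.1)
        (v := fun n => scaled (k n / n) q.1.2) (fun n => scaled_mem_Icc _ _)
        (fun n => scaled_mem_Icc _ _) (fun n hn => (hscaled q n hn).1)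
        (fun n hn => (hscaled q n hn).2)] with ω hω
      simpa only [rawLower, lowerRescaled_sub_lowerRescaled] using hω
    filter_upwards [hpt, hinj] with ω hω hi
    exact hconv _ (fun n => rawLower n (k n) (fun i => X i ω) (fun i => Y i ω))
      (fun n => lowerRescaled C (k n / n)) Λ _ _ he hb
      (fun n hn => quasiLipschitz_lowerRescaled (ht n hn) fun u hu u' hu' v hv v' hv' =>
        abs_empiricalCopula_sub_le hn hi.1.injOn hi.2.injOn hu hu' hv hv')
      (QuasiLipschitz.of_tendsto (fun t ht => by
        simpa using quasiLipschitz_lowerRescaled ht hCδ) hΛ)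
      (fun n hn p => (abs_checkerboardTail_sub_rawTail_le hn (hm n hn) (hk n hn) hi.1.injOn
        hi.2.injOn p).1)
      (fun n => (exists_bound_checkerboardTail (hm n) _ _ _).1)
      (fun p => (hΛ p).comp ht0) hω
  · have hpt : ∀ᵐ ω ∂P, ∀ q ∈ Q, Tendsto (fun n =>
        rawUpper n (k n) (fun i => X i ω) (fun i => Y i ω) q - upperRescaled C (k n / n) q)
        atTop (𝓝 0) := by
      refine (ae_ball_iff hQ).2 fun q _ => ?_
      filter_upwards [ae_tendsto_empiricalCopula_sub_div hX hY hindep hident hF hG hC hSklar hk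
        hk_top hlog hinj (u := fun n => 1 - scaled (k n / n) q.1.1)
        (v := fun n => 1 - scaled (k n / n) q.1.2) (fun n => one_sub_mem_Icc (scaled_mem_Icc _ _))
        (fun n => one_sub_mem_Icc (scaled_mem_Icc _ _))
        -- The variance `s (1 - s)` is invariant under `s ↦ 1 - s`, so the lower tail bound applies.
        (fun n hn => by rw [sub_sub_cancel, mul_comm]; exact (hscaled q n hn).1)
        (fun n hn => by rw [sub_sub_cancel, mul_comm]; exact (hscaled q n hn).2)] with ω hω
      simpa only [rawUpper, upperRescaled_sub_upperRescaled] using hω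
    filter_upwards [hpt, hinj] with ω hω hi
    exact hconv _ (fun n => rawUpper n (k n) (fun i => X i ω) (fun i => Y i ω))
      (fun n => upperRescaled C (k n / n)) Λ _ _ he hb
      (fun n hn => quasiLipschitz_upperRescaled (ht n hn) fun u hu u' hu' v hv v' hv' =>
        abs_empiricalCopula_sub_le hn hi.1.injOn hi.2.injOn hu hu' hv hv')
      (QuasiLipschitz.of_tendsto (fun t ht => by
        simpa using quasiLipschitz_upperRescaled ht hCδ) hΛ)
      (fun n hn p => (abs_checkerboardTail_sub_rawTail_le hn (hm n hn) (hk n hn) hi.1.injOn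
        hi.2.injOn p).2)
      (fun n => (exists_bound_checkerboardTail (hm n) _ _ _).2)
      (fun p => (hΛ p).comp ht0) hω
  · filter_upwards [hinj] with ω hi n hn p
    obtain ⟨h1, h2⟩ := abs_checkerboardTail_sub_rawTail_le hn (hm n hn) (hk n hn) hi.1.injOn
      hi.2.injOn p
    -- Here `2 / k = 2 m / (k m)`, and `m ≤ n` is used in the numerator.
    have hle : m n ≤ n → 2 * n / (k n * m n) + 2 / k n ≤ 4 * n / (k n * m n) := by
      intro hmn
      have hm' : (0 : ℝ) < m n := by exact_mod_cast hm n hn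
      have hk' := hk n hn
      have hmn' : (m n : ℝ) ≤ n := by exact_mod_cast hmn
      have h3 : 2 / k n = 2 * m n / (k n * m n) := by field_simp
      rw [h3, ← add_div]
      gcongr
      linarith
    exact ⟨h1, h2, fun hmn => ⟨h1.trans (hle hmn), h2.trans (hle hmn)⟩⟩
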